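/- **Setting.** Let $G$ be a connected undirected graph on $n\ge 2$ nodes with ids $0,\dots,n-1$ and maximum degree $\Delta$, let $S$ be a set of $k$ source nodes, each with its own rumor, and let $1\le c\le k$. A message is a transmission by a node $u$ of a batch of at most $c$ rumors that $u$ knows at that moment; all neighbours of $u$ learn these rumors. A multi-broadcast schedule is a finite sequence of messages after which all nodes know all $k$ rumors (initially each source knows only its own rumor, and the other nodes know none); $m_{opt}$ is the minimum number of messages of such a schedule. A connected dominating set (CDS) is a nonempty set $D$ of nodes that induces a connected subgraph and such that every node is in $D$ or has a neighbour in $D$; $|D_{opt}|$ is the minimum size of a CDS. $H(i)=\sum_{j=1}^{i}1/j$. A unit disk graph (UDG) is a graph whose nodes are points of the plane, two distinct nodes being adjacent iff their Euclidean distance is less than a common radius $r>0$. **Algorithm (message-efficient multi-broadcast).** (1) Find a CDS $D$ by a subroutine (below). (2) Let $r$ be the node of lowest id, and build a spanning tree, rooted at $r$, of the subgraph induced by $D\cup\{r\}$. (3) Every source outside $D\cup\{r\}$ sends its rumor to a neighbour in $D\cup\{r\}$; then, children before parents, every tree node other than $r$ sends all rumors that it holds to its parent, in as few batches as possible. (4)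 From $r$ outwards, every node of the tree sends all $k$ rumors in $\lceil k/c\rceil$ batches. *Subroutine for general graphs.* Start with no black node. A non-black node is gray if it has a black neighbour and white otherwise; a piece is a white node or a connected component of the subgraph induced by the black nodes. While some single node, if blackened, reduces the number of pieces, blacken one that reduces it most. Then, while there is a chain of at most two nodes whose blackening reduces the number of pieces, blacken one that reduces it most. $D$ is the set of black nodes. *Subroutine for UDG.* Start from the lowest id node and repeatedly add a node at distance exactly two from the current set, as long as there is one, which gives a set $I$. Then blacken $I$ and, while some single node, if blackened, reduces the number of pieces, blacken one that reduces it most. **Theorem.** There is a polynomial $P$ such that, for all $G$, $S$, $c$ as above, with the general subroutine the algorithm takes at most $P(n)$ elementary steps, finds a CDS $D$ with $|D|\le (2+H(\Delta))\,|D_{opt}|$, and outputs a multi-broadcast schedule; if $c$ divides $k$ (so that $k/c$ is a number of messages), this schedule has at most $$(2H(\Delta)+5)\Bigl(1+\frac1c\Bigr)m_{opt}$$ messages. If moreover $G$ is a UDG, then with the UDG subroutine the algorithm takes at most $P(n)$ steps, finds a CDS $D$ with $|D|\le 7.8\,|D_{opt}|$, and outputs a multi-broadcast schedule, which for $c\mid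 k$ has at most $$15.6\Bigl(1+\frac1c\Bigr)m_{opt}$$ messages. If $c$ does not divide $k$, the two message bounds hold with the additional rounding factor $\lceil k/c\rceil/(k/c)$ (which is less than $2$, and equal to $1$ if $c\mid k$). -/

import Mathlib

/- Nodes are `Fin n`; a node's number is its id. A rumor is named by its (unique) source. -/

namespace MultiBroadcast

/-! ### Schedules and their number of messages -/

/-- A message `(u, b)`: node `u` transmits the batch `b` of rumors to all its neighbours. -/
abbrev Msg (n : ℕ) : Type := Fin n × List (Fin n)

/-- Which rumors each node knows. -/
abbrev Knowledge (n : ℕ) : Type := Fin n → Set (Fin n)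

/-- At the beginning every source knows exactly its own rumor, other nodes know nothing. -/
def initialKnowledge {n : ℕ} (S : Finset (Fin n)) : Knowledge n :=
  fun v => {s | s = v ∧ s ∈ S}

/-- The effect of one transmission: every neighbour of the sender learns the batch. -/
def deliver {n : ℕ} (G : SimpleGraph (Fin n)) (K : Knowledge n) (m : Msg n) : Knowledge n :=
  fun v => K v ∪ {s | G.Adj m.1 v ∧ s ∈ m.2}

/-- What the nodes know after the transmissions of a schedule, in this order. -/
def knowledgeAfter {n : ℕ} (G : SimpleGraph (Fin n)) (K : Knowledge n) (σ : List (Msg n)) :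
    Knowledge n :=
  σ.foldl (deliver G) K

/-- Every message carries at most `c` rumors, all of them known to its sender at that moment. -/
def Feasible {n : ℕ} (G : SimpleGraph (Fin n)) (c : ℕ) : Knowledge n → List (Msg n) → Prop
  | _, [] => True
  | K, m :: σ => (m.2.length ≤ c ∧ ∀ s ∈ m.2, s ∈ K m.1) ∧ Feasible G c (deliver G K m) σ

/-- A feasible schedule after which every node knows the rumor of every source. -/
def IsMultiBroadcast {n : ℕ} (G : SimpleGraph (Fin n)) (S : Finset (Fin n)) (c : ℕ)
    (σ : List (Msg n)) : Prop :=
  Feasible G c (initialKnowledge S) σ ∧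
    ∀ v, ∀ s ∈ S, s ∈ knowledgeAfter G (initialKnowledge S) σ v

/-- The minimum number of messages of a multi-broadcast schedule. -/
noncomputable def mOpt {n : ℕ} (G : SimpleGraph (Fin n)) (S : Finset (Fin n)) (c : ℕ) : ℕ :=
  sInf {m | ∃ σ : List (Msg n), IsMultiBroadcast G S c σ ∧ σ.length = m}

/-! ### Connected dominating sets, unit disk graphs -/

/-- `D` is a connected (in particular nonempty) dominating set. -/
def IsCDS {n : ℕ} (G : SimpleGraph (Fin n)) (D : Finset (Fin n)) : Prop :=
  (∀ v, v ∈ D ∨ ∃ u ∈ D, G.Adj u v) ∧ (G.induce (D : Set (Fin n))).Connected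

/-- The minimum size of a connected dominating set. -/
noncomputable def minCDS {n : ℕ} (G : SimpleGraph (Fin n)) : ℕ :=
  sInf {m | ∃ D : Finset (Fin n), IsCDS G D ∧ D.card = m}

/-- Nodes are points of the plane, all with the same transmission radius `r`. -/
def IsUnitDiskGraph {n : ℕ} (G : SimpleGraph (Fin n)) : Prop :=
  ∃ (x : Fin n → EuclideanSpace ℝ (Fin 2)) (r : ℝ), 0 < r ∧
    ∀ u v, G.Adj u v ↔ u ≠ v ∧ dist (x u) (x v) < r

/-! ### Cost model

A computation returns a value together with the number of elementary steps it took. All work is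
done by the routines below, which charge one step (`tick`) for each list cell visited or created,
each comparison of ids or counters, and each adjacency query. -/

structure Timed (α : Type) where
  val : α
  cost : ℕ

namespace Timed

instance : Monad Timed where
  pure a := ⟨a, 0⟩
  bind x f := ⟨(f x.val).val, x.cost + (f x.val).cost⟩

/-- Return `a` after one elementary step. -/
def tick {α : Type} (a : α) : Timed α := ⟨a, 1⟩

def anyT {α : Type} (p : α → Timed Bool) : List α → Timed Bool
  | [] => tick false
  | a :: l => do
    let b ← p a
    let r ← anyT p l
    tick (b || r)

def countT {α : Type} (p : α → Timed Bool) : List α → Timed ℕ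
  | [] => tick 0
  | a :: l => do
    let b ← p a
    let r ← countT p l
    tick (if b then r + 1 else r)

def filterT {α : Type} (p : α → Timed Bool) : List α → Timed (List α)
  | [] => tick []
  | a :: l => do
    let b ← p a
    let r ← filterT p l
    tick (if b then a :: r else r)

/-- The first element of the list that satisfies `p`. -/
def findT {α : Type} (p : α → Timed Bool) : List α → Timed (Option α)
  | [] => tick none
  | a :: l => do
    let b ← p a
    if b then tick (some a) else findT p l

def mapT {α β : Type} (f : α → Timed β) : List α → Timed (List β)
  | [] => tick []
  | a :: l => do
    let b ← f a
    let r ← mapT f l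
    tick (b :: r)

def lengthT {α : Type} : List α → Timed ℕ
  | [] => tick 0
  | _ :: l => do
    let r ← lengthT l
    tick (r + 1)

def appendT {α : Type} (l₁ l₂ : List α) : Timed (List α) :=
  match l₁ with
  | [] => tick l₂
  | a :: l => do
    let r ← appendT l l₂
    tick (a :: r)

def flatMapT {α β : Type} (f : α → Timed (List β)) : List α → Timed (List β)
  | [] => tick []
  | a :: l => do
    let b ← f a
    let r ← flatMapT f l
    appendT b r

/-- The first element of the list with the smallest value of `f`, and that value. -/
def argminT {α : Type} (f : α → Timed ℕ) : List α → Timed (Option (α × ℕ))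
  | [] => tick none
  | a :: l => do
    let k ← f a
    let r ← argminT f l
    match r with
    | none => tick (some (a, k))
    | some (b, k') => tick (if k ≤ k' then some (a, k) else some (b, k'))

/-- `f` applied `m` times. -/
def iterT {α : Type} (f : α → Timed α) : ℕ → α → Timed α
  | 0, a => tick a
  | m + 1, a => do
    let b ← f a
    iterT f m b

end Timed

open Timed

/-- Is the node `x` in the list? -/
def memT {n : ℕ} (x : Fin n) (B : List (Fin n)) : Timed Bool :=
  anyT (fun y => tick (decide (x = y))) B

/-- Add a node to a list that represents a set. -/
def insertT {n : ℕ} (x : Fin n) (B : List (Fin n)) : Timed (List (Fin n)) := do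
  let b ← memT x B
  tick (if b then B else x :: B)

def unionT {n : ℕ} : List (Fin n) → List (Fin n) → Timed (List (Fin n))
  | [], B => tick B
  | x :: X, B => do
    let r ← unionT X B
    insertT x r

/-! ### Connected dominating sets: greedy algorithms -/

/-- Is some node of `B` adjacent to `x`? -/
def hasNeighborT {n : ℕ} (G : SimpleGraph (Fin n)) [DecidableRel G.Adj] (B : List (Fin n))
    (x : Fin n) : Timed Bool :=
  anyT (fun y => tick (decide (G.Adj x y))) B

/-- For `x ∈ B`: the nodes of the connected component of `x` in the graph induced by `B`. -/
def componentT {n : ℕ} (G : SimpleGraph (Fin n)) [DecidableRel G.Adj] (B : List (Fin n))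
    (x : Fin n) : Timed (List (Fin n)) :=
  iterT (fun R => filterT (fun y => anyT (fun z => tick (decide (y = z ∨ G.Adj y z))) R) B) n [x]

/-- The number of pieces. Nodes of `B` are black, other nodes with a neighbour in `B` are gray, all
others are white. A piece is a white node or a connected component of the graph induced by the
black nodes; a component is counted at its node of lowest id. -/
def piecesT {n : ℕ} (G : SimpleGraph (Fin n)) [DecidableRel G.Adj] (B : List (Fin n)) : Timed ℕ :=
  countT (fun x => do
    let black ← memT x B
    if black then
      let C ← componentT G B x
      let notLowest ← anyT (fun y => tick (decide (y < x))) C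
      tick (!notLowest)
    else
      let gray ← hasNeighborT G B x
      tick (!gray)) (List.finRange n)

/-- As long as adding one of the candidate sets to `B` reduces the number of pieces, add one that
reduces it most (at most `fuel` times). -/
def greedyT {n : ℕ} (G : SimpleGraph (Fin n)) [DecidableRel G.Adj]
    (cands : List (List (Fin n))) : ℕ → List (Fin n) → Timed (List (Fin n))
  | 0, B => tick B
  | fuel + 1, B => do
    let p ← piecesT G B
    let o ← argminT (fun X => do
      let B' ← unionT X B
      piecesT G B') cands
    match o with
    | none => tick B
    | some (X, q) =>
      if q < p then
        let B' ← unionT X B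
        greedyT G cands fuel B'
      else tick B

def singlesT (n : ℕ) : Timed (List (List (Fin n))) :=
  mapT (fun v => tick [v]) (List.finRange n)

def pairsT (n : ℕ) : Timed (List (List (Fin n))) :=
  flatMapT (fun u => mapT (fun v => tick [u, v]) (List.finRange n)) (List.finRange n)

/-- The two-phase greedy algorithm for general graphs: first blacken single nodes that
reduce the number of pieces most, then join black components by chains of at most two nodes. -/
def greedyCDS {n : ℕ} (G : SimpleGraph (Fin n)) [DecidableRel G.Adj] : Timed (List (Fin n)) := do
  let singles ← singlesT n
  let B ← greedyT G singles n []
  let pairs ← pairsT n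
  greedyT G pairs n B

/-- Extend the independent set `I` to a maximal one, each time by a node at distance exactly two
from it: a node that is neither in `I` nor adjacent to `I`, but has a neighbour adjacent to `I`. -/
def extendMIS {n : ℕ} (G : SimpleGraph (Fin n)) [DecidableRel G.Adj] :
    ℕ → List (Fin n) → Timed (List (Fin n))
  | 0, I => tick I
  | fuel + 1, I => do
    let o ← findT (fun x => do
      let a ← memT x I
      let b ← hasNeighborT G I x
      let d ← anyT (fun y => do
        let e ← hasNeighborT G I y
        tick (decide (G.Adj x y) && e)) (List.finRange n)
      tick (!a && !b && d)) (List.finRange n)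
    match o with
    | none => tick I
    | some x => extendMIS G fuel (x :: I)

/-- The algorithm for unit disk graphs: a maximal independent set, grown from the node of
lowest id, is connected by greedily chosen single nodes. -/
def misCDS {n : ℕ} (G : SimpleGraph (Fin n)) [DecidableRel G.Adj] : Timed (List (Fin n)) :=
  match List.finRange n with
  | [] => tick []
  | r :: _ => do
    let I ← extendMIS G n [r]
    let singles ← singlesT n
    greedyT G singles n I

/-! ### The multi-broadcast algorithm -/

/-- Split a list of rumors into batches of size `c` (and at most one smaller batch). -/
def batchesT {n : ℕ} (c : ℕ) : List (Fin n) → Timed (List (List (Fin n)))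
  | [] => tick []
  | s :: l => do
    let bs ← batchesT c l
    match bs with
    | [] => tick [[s]]
    | b :: bs' => do
      let k ← lengthT b
      tick (if k < c then (s :: b) :: bs' else [s] :: b :: bs')

/-- Grow a tree in the graph induced by the node list `B`. A tree is a list of pairs
`(node, parent)`, latest node first; the root is its own parent. -/
def treeT {n : ℕ} (G : SimpleGraph (Fin n)) [DecidableRel G.Adj] (B : List (Fin n)) :
    ℕ → List (Fin n × Fin n) → Timed (List (Fin n × Fin n))
  | 0, T => tick T
  | fuel + 1, T => do
    let o ← findT (fun v => do
      let a ← anyT (fun e => tick (decide (e.1 = v))) T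
      let b ← anyT (fun e => tick (decide (G.Adj e.1 v))) T
      tick (!a && b)) B
    match o with
    | none => tick T
    | some v => do
      let q ← findT (fun e => tick (decide (G.Adj e.1 v))) T
      match q with
      | none => tick T
      | some e => treeT G B fuel ((v, e.1) :: T)

/-- Sources outside `B` send their rumor to a neighbour in `B`. Returns the messages and the list of
pairs `(holder, rumor)`. -/
def enterT {n : ℕ} (G : SimpleGraph (Fin n)) [DecidableRel G.Adj] (B : List (Fin n)) :
    List (Fin n) → Timed (List (Msg n) × List (Fin n × Fin n))
  | [] => tick ([], [])
  | s :: l => do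
    let r ← enterT G B l
    let b ← memT s B
    if b then tick (r.1, (s, s) :: r.2)
    else
      let q ← findT (fun p => tick (decide (G.Adj s p))) B
      match q with
      | none => tick r
      | some p => tick ((s, [s]) :: r.1, (p, s) :: r.2)

/-- Convergecast along the tree, children before parents: every node other than the root sends the
rumors that it holds to its parent, in batches of size `c`. -/
def collectT {n : ℕ} (c : ℕ) :
    List (Fin n × Fin n) → List (Fin n × Fin n) → Timed (List (Msg n))
  | [], _ => tick []
  | (v, p) :: T, h =>
    if v = p then tick []
    else do
      let mine ← filterT (fun x => tick (decide (x.1 = v))) h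
      let rumors ← mapT (fun x => tick x.2) mine
      let bs ← batchesT c rumors
      let msgs ← mapT (fun b => tick (v, b)) bs
      let h' ← mapT (fun x => tick (if x.1 = v then (p, x.2) else x)) h
      let rest ← collectT c T h'
      appendT msgs rest

/-- Dissemination along the tree, parents before children: every node of the tree sends all the
given batches. -/
def disseminateT {n : ℕ} (bs : List (List (Fin n))) :
    List (Fin n × Fin n) → Timed (List (Msg n))
  | [] => tick []
  | (v, _) :: T => do
    let before ← disseminateT bs T
    let msgs ← mapT (fun b => tick (v, b)) bs
    appendT before msgs

/-- The message-efficient multi-broadcast algorithm, with the subroutine `cds` that finds a connected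
dominating set `D`. The root `r` is the node of lowest id, the backbone is `D ∪ {r}`. -/
def messageEfficient {n : ℕ} (G : SimpleGraph (Fin n)) [DecidableRel G.Adj]
    (cds : Timed (List (Fin n))) (S : List (Fin n)) (c : ℕ) : Timed (List (Msg n)) := do
  let D ← cds
  match List.finRange n with
  | [] => tick []
  | r :: _ => do
    let B ← insertT r D
    let T ← treeT G B n [(r, r)]
    let e ← enterT G B S
    let up ← collectT c T e.2
    let bs ← batchesT c S
    let down ← disseminateT bs T
    let rest ← appendT up down
    appendT e.1 rest

/-- With the subroutine `cds` of approximation ratio `α`, the algorithm is a `ρ`-approximation on this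
instance, within `t` steps: the subroutine finds a connected dominating set of at most `α` times
the minimum size, and the output is a multi-broadcast schedule with at most `ρ * mOpt` messages if
`c` divides the number `k` of rumors, and in general at most `ρ * mOpt` times the rounding factor
`⌈k / c⌉ / (k / c)` (which is `1` if `c` divides `k`). -/
def Approximates {n : ℕ} (G : SimpleGraph (Fin n)) [DecidableRel G.Adj]
    (cds : Timed (List (Fin n))) (S : Finset (Fin n)) (c : ℕ) (α ρ : ℝ) (t : ℕ) : Prop :=
  let A := messageEfficient G cds (S.sort (· ≤ ·)) c
  A.cost ≤ t ∧
  (IsCDS G cds.val.toFinset ∧ (cds.val.length : ℝ) ≤ α * minCDS G) ∧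
  IsMultiBroadcast G S c A.val ∧
  (c ∣ S.card → (A.val.length : ℝ) ≤ ρ * mOpt G S c) ∧
  (A.val.length : ℝ) ≤ (⌈(S.card : ℝ) / c⌉₊ / ((S.card : ℝ) / c)) * (ρ * mOpt G S c)

end MultiBroadcast

/-!
The number of messages is compared with two lower bounds for the optimum. In any schedule, the
transmitters of one fixed rumor form a connected dominating set that contains the source of the
rumor (`IsMultiBroadcast.isCDS_sendersOf`). So each of the `k` sources transmits, which needs `k`
messages, and each rumor is transmitted at least `d` times, where `d` is the minimum size of a
connected dominating set, which needs `k d / c` messages. With a connected dominating set of at most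
`α d` nodes the algorithm sends at most `k + (2 α d + 1) ⌈k / c⌉` messages (`messageEfficient_spec`),
and this is at most `(2 α + 1) (1 + 1 / c)` times the optimum up to rounding (`message_bound`). It
remains to find connected dominating sets with `α = 2 + H(Δ)` and, for unit disk graphs, `α = 7.3`.

Both subroutines are analysed through the number `a` of pieces. Blackening a connected set of nodes
merges all pieces that it touches (`card_pieces_union_add_card_touched`). The nodes of an optimal
connected dominating set together touch all pieces, so the best single node removes at least
`⌈a / d⌉ - 1` of them. Summing the reciprocals of these reductions gives a potential function that
pays for all nodes chosen (`length_add_potential_le`). For general graphs there are at most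
`(Δ + 1) d` pieces at the beginning, and at most `d` when no single node helps any more; each of
these costs at most two nodes in the second phase (`length_greedyCDS_le`). The second phase only
stops with a single piece, as some two adjacent nodes touch different pieces otherwise
(`exists_pair_card_pieces_lt`).

In a unit disk graph, an open disk of radius `r` contains at most five points at mutual distance at
least `r`; along a connected order of an optimal connected dominating set, every node but the first
one therefore accounts for at most four further independent nodes
(`IsUnitDiskGraph.card_independent_le`). So the maximal independent set has at most `4 d + 1` nodes.
As each of its nodes was at distance two from the earlier ones, single nodes suffice to connect it
(`GrownFrom.card_pieces_le_one`), and the potential function bounds their number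
(`length_misCDS_le`).
-/

namespace MultiBroadcast

open Timed

/-! ### Values and costs of the timed routines -/

namespace Timed

variable {α β : Type}

@[simp] theorem val_bind (x : Timed α) (f : α → Timed β) : (x >>= f).val = (f x.val).val := rfl

@[simp] theorem cost_bind (x : Timed α) (f : α → Timed β) :
    (x >>= f).cost = x.cost + (f x.val).cost := rfl

@[simp] theorem val_tick (a : α) : (tick a).val = a := rfl

@[simp] theorem cost_tick (a : α) : (tick a).cost = 1 := rfl

@[simp] theorem anyT_val (p : α → Timed Bool) (l : List α) :
    (anyT p l).val = l.any fun a => (p a).val := by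
  induction l with
  | nil => rfl
  | cons a l ih => simp [anyT, ih]

@[simp] theorem countT_val (p : α → Timed Bool) (l : List α) :
    (countT p l).val = l.countP fun a => (p a).val := by
  induction l with
  | nil => rfl
  | cons a l ih => by_cases h : (p a).val <;> simp [countT, ih, h]

@[simp] theorem filterT_val (p : α → Timed Bool) (l : List α) :
    (filterT p l).val = l.filter fun a => (p a).val := by
  induction l with
  | nil => rfl
  | cons a l ih => by_cases h : (p a).val <;> simp [filterT, ih, h]

@[simp] theorem findT_val (p : α → Timed Bool) (l : List α) :
    (findT p l).val = l.find? fun a => (p a).val := by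
  induction l with
  | nil => rfl
  | cons a l ih => by_cases h : (p a).val <;> simp [findT, ih, h]

@[simp] theorem mapT_val (f : α → Timed β) (l : List α) :
    (mapT f l).val = l.map fun a => (f a).val := by
  induction l with
  | nil => rfl
  | cons a l ih => simp [mapT, ih]

@[simp] theorem lengthT_val (l : List α) : (lengthT l).val = l.length := by
  induction l with
  | nil => rfl
  | cons a l ih => simp [lengthT, ih]

@[simp] theorem appendT_val (l₁ l₂ : List α) : (appendT l₁ l₂).val = l₁ ++ l₂ := by
  induction l₁ with
  | nil => rfl
  | cons a l ih => simp [appendT, ih]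

@[simp] theorem flatMapT_val (f : α → Timed (List β)) (l : List α) :
    (flatMapT f l).val = l.flatMap fun a => (f a).val := by
  induction l with
  | nil => rfl
  | cons a l ih => simp [flatMapT, ih]

@[simp] theorem iterT_val (f : α → Timed α) (m : ℕ) (a : α) :
    (iterT f m a).val = (fun a => (f a).val)^[m] a := by
  induction m generalizing a with
  | zero => rfl
  | succ m ih => simp [iterT, ih]

theorem argminT_val_eq_none {f : α → Timed ℕ} {l : List α} :
    (argminT f l).val = none ↔ l = [] := by
  cases l with
  | nil => simp [argminT]
  | cons a l =>
    simp only [argminT, val_bind]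
    rcases (argminT f l).val with _ | ⟨b, k⟩
    · simp
    · simp only [val_tick]; split_ifs <;> simp

theorem argminT_val_eq_some {f : α → Timed ℕ} {l : List α} {b : α} {k : ℕ}
    (h : (argminT f l).val = some (b, k)) :
    b ∈ l ∧ k = (f b).val ∧ ∀ a ∈ l, k ≤ (f a).val := by
  induction l generalizing b k with
  | nil => simp [argminT] at h
  | cons a l ih =>
    simp only [argminT, val_bind] at h
    rcases hr : (argminT f l).val with _ | ⟨b', k'⟩
    · rw [argminT_val_eq_none] at hr
      subst hr
      simp only [argminT, val_tick, Option.some.injEq, Prod.mk.injEq] at h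
      obtain ⟨rfl, rfl⟩ := h
      simp
    · obtain ⟨h1, h2, h3⟩ := ih hr
      simp only [hr, val_tick] at h
      split_ifs at h with hk
      · simp only [Option.some.injEq, Prod.mk.injEq] at h
        obtain ⟨rfl, rfl⟩ := h
        refine ⟨by simp, rfl, ?_⟩
        simp only [List.mem_cons, forall_eq_or_imp, le_refl, true_and]
        exact fun x hx => hk.trans (h3 x hx)
      · simp only [Option.some.injEq, Prod.mk.injEq] at h
        obtain ⟨rfl, rfl⟩ := h
        refine ⟨by simp [h1], h2, ?_⟩
        simp only [List.mem_cons, forall_eq_or_imp]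
        exact ⟨by omega, h3⟩

theorem anyT_cost {p : α → Timed Bool} {l : List α} {C : ℕ} (h : ∀ a ∈ l, (p a).cost ≤ C) :
    (anyT p l).cost ≤ l.length * (C + 1) + 1 := by
  induction l with
  | nil => simp [anyT]
  | cons a l ih =>
    have h1 := h a (by simp)
    have h2 := ih fun x hx => h x (by simp [hx])
    simp only [anyT, cost_bind, cost_tick, List.length_cons]
    linarith

theorem countT_cost {p : α → Timed Bool} {l : List α} {C : ℕ} (h : ∀ a ∈ l, (p a).cost ≤ C) :
    (countT p l).cost ≤ l.length * (C + 1) + 1 := by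
  induction l with
  | nil => simp [countT]
  | cons a l ih =>
    have h1 := h a (by simp)
    have h2 := ih fun x hx => h x (by simp [hx])
    simp only [countT, cost_bind, cost_tick, List.length_cons]
    linarith

theorem filterT_cost {p : α → Timed Bool} {l : List α} {C : ℕ} (h : ∀ a ∈ l, (p a).cost ≤ C) :
    (filterT p l).cost ≤ l.length * (C + 1) + 1 := by
  induction l with
  | nil => simp [filterT]
  | cons a l ih =>
    have h1 := h a (by simp)
    have h2 := ih fun x hx => h x (by simp [hx])
    simp only [filterT, cost_bind, cost_tick, List.length_cons]
    linarith

theorem findT_cost {p : α → Timed Bool} {l : List α} {C : ℕ} (h : ∀ a ∈ l, (p a).cost ≤ C) :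
    (findT p l).cost ≤ l.length * (C + 1) + 1 := by
  induction l with
  | nil => simp [findT]
  | cons a l ih =>
    have h1 := h a (by simp)
    have h2 := ih fun x hx => h x (by simp [hx])
    simp only [findT, cost_bind, List.length_cons]
    split_ifs
    · simp only [cost_tick]; nlinarith
    · linarith

theorem mapT_cost {f : α → Timed β} {l : List α} {C : ℕ} (h : ∀ a ∈ l, (f a).cost ≤ C) :
    (mapT f l).cost ≤ l.length * (C + 1) + 1 := by
  induction l with
  | nil => simp [mapT]
  | cons a l ih =>
    have h1 := h a (by simp)
    have h2 := ih fun x hx => h x (by simp [hx])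
    simp only [mapT, cost_bind, cost_tick, List.length_cons]
    linarith

theorem argminT_cost {f : α → Timed ℕ} {l : List α} {C : ℕ} (h : ∀ a ∈ l, (f a).cost ≤ C) :
    (argminT f l).cost ≤ l.length * (C + 1) + 1 := by
  induction l with
  | nil => simp [argminT]
  | cons a l ih =>
    have h1 := h a (by simp)
    have h2 := ih fun x hx => h x (by simp [hx])
    simp only [argminT, cost_bind, List.length_cons]
    rcases (argminT f l).val with _ | ⟨b, k⟩ <;> simp only [cost_tick] <;> linarith

theorem lengthT_cost (l : List α) : (lengthT l).cost = l.length + 1 := by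
  induction l with
  | nil => rfl
  | cons a l ih => simp [lengthT, ih]

theorem appendT_cost (l₁ l₂ : List α) : (appendT l₁ l₂).cost = l₁.length + 1 := by
  induction l₁ with
  | nil => rfl
  | cons a l ih => simp [appendT, ih]

theorem flatMapT_cost {f : α → Timed (List β)} {l : List α} {C : ℕ}
    (h : ∀ a ∈ l, (f a).cost + (f a).val.length ≤ C) :
    (flatMapT f l).cost ≤ l.length * (C + 1) + 1 := by
  induction l with
  | nil => simp [flatMapT]
  | cons a l ih =>
    have h1 := h a (by simp)
    have h2 := ih fun x hx => h x (by simp [hx])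
    simp only [flatMapT, cost_bind, appendT_cost, List.length_cons]
    linarith

/-- The cost of iterating a routine whose arguments keep an invariant `Q` that bounds the cost of
a single application. -/
theorem iterT_cost {f : α → Timed α} {C : ℕ} (Q : α → Prop)
    (h : ∀ a, Q a → (f a).cost ≤ C ∧ Q (f a).val) (m : ℕ) {a : α} (ha : Q a) :
    (iterT f m a).cost ≤ m * C + 1 := by
  induction m generalizing a with
  | zero => simp [iterT]
  | succ m ih =>
    have h1 := h a ha
    have h2 := ih h1.2
    simp only [iterT, cost_bind]
    linarith

end Timed

variable {n : ℕ}

@[simp] theorem memT_val (x : Fin n) (B : List (Fin n)) : (memT x B).val = decide (x ∈ B) := by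
  simp only [memT, anyT_val, val_tick]
  rw [Bool.eq_iff_iff]
  simp

theorem memT_cost (x : Fin n) (B : List (Fin n)) : (memT x B).cost ≤ B.length * 2 + 1 :=
  anyT_cost fun _ _ => le_rfl

theorem insertT_val (x : Fin n) (B : List (Fin n)) :
    (insertT x B).val = if x ∈ B then B else x :: B := by
  simp [insertT]

theorem insertT_cost (x : Fin n) (B : List (Fin n)) :
    (insertT x B).cost ≤ B.length * 2 + 2 := by
  have := memT_cost x B
  simp only [insertT, cost_bind, cost_tick]
  omega

theorem mem_insertT {x y : Fin n} {B : List (Fin n)} :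
    y ∈ (insertT x B).val ↔ y = x ∨ y ∈ B := by
  rw [insertT_val]
  split_ifs with h
  · exact ⟨Or.inr, by rintro (rfl | h') <;> assumption⟩
  · simp

theorem nodup_insertT {x : Fin n} {B : List (Fin n)} (hB : B.Nodup) :
    (insertT x B).val.Nodup := by
  rw [insertT_val]
  split_ifs with h
  · exact hB
  · exact List.nodup_cons.2 ⟨h, hB⟩

theorem length_insertT (x : Fin n) (B : List (Fin n)) :
    (insertT x B).val.length ≤ B.length + 1 := by
  rw [insertT_val]
  split_ifs <;> simp

theorem mem_unionT {X B : List (Fin n)} {y : Fin n} :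
    y ∈ (unionT X B).val ↔ y ∈ X ∨ y ∈ B := by
  induction X with
  | nil => simp [unionT]
  | cons x X ih => simp [unionT, mem_insertT, ih, or_assoc]

theorem nodup_unionT {X B : List (Fin n)} (hB : B.Nodup) : (unionT X B).val.Nodup := by
  induction X with
  | nil => simpa [unionT] using hB
  | cons x X ih => exact nodup_insertT ih

theorem length_unionT (X B : List (Fin n)) :
    (unionT X B).val.length ≤ B.length + X.length := by
  induction X with
  | nil => simp [unionT]
  | cons x X ih =>
    have := length_insertT x (unionT X B).val
    simp only [unionT, val_bind, List.length_cons]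
    omega

theorem length_le_of_nodup {B : List (Fin n)} (hB : B.Nodup) : B.length ≤ n := by
  simpa using hB.length_le_card

theorem unionT_cost {B : List (Fin n)} (hB : B.Nodup) (X : List (Fin n)) :
    (unionT X B).cost ≤ X.length * (2 * n + 2) + 1 := by
  induction X with
  | nil => simp [unionT]
  | cons x X ih =>
    have h1 := insertT_cost x (unionT X B).val
    have h2 := length_le_of_nodup (nodup_unionT (X := X) hB)
    simp only [unionT, cost_bind, List.length_cons]
    linarith

/-! ### Pieces -/

/-- The graph on all nodes whose edges are the edges of `G` between black nodes. -/
def blackGraph (G : SimpleGraph (Fin n)) (B : Set (Fin n)) : SimpleGraph (Fin n) where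
  Adj u v := G.Adj u v ∧ u ∈ B ∧ v ∈ B
  symm := ⟨fun _ _ h => ⟨h.1.symm, h.2.2, h.2.1⟩⟩
  loopless := ⟨fun _ h => G.loopless.irrefl _ h.1⟩

/-- `x` represents a piece: it is the node of lowest id in a black component, or it is white. -/
def IsRep (G : SimpleGraph (Fin n)) (B : Set (Fin n)) (x : Fin n) : Prop :=
  (x ∈ B ∧ ∀ y, (blackGraph G B).Reachable x y → x ≤ y) ∨ (x ∉ B ∧ ∀ y ∈ B, ¬ G.Adj x y)

open Classical in
/-- The pieces of the coloring with black set `B`, each given by its representative. The nodes of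
the piece of `x` are the nodes that are reachable from `x` in `blackGraph G B`. -/
noncomputable def pieces (G : SimpleGraph (Fin n)) (B : Set (Fin n)) : Finset (Fin n) :=
  Finset.univ.filter (IsRep G B)

open Classical in
/-- The pieces that meet the closed neighbourhood of a node of `X`. -/
noncomputable def touched (G : SimpleGraph (Fin n)) (B X : Set (Fin n)) : Finset (Fin n) :=
  (pieces G B).filter fun x =>
    ∃ v ∈ X, ∃ z, (blackGraph G B).Reachable x z ∧ (z = v ∨ G.Adj z v)

theorem mem_pieces {G : SimpleGraph (Fin n)} {B : Set (Fin n)} {x : Fin n} :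
    x ∈ pieces G B ↔ IsRep G B x := by
  simp [pieces]

theorem mem_touched {G : SimpleGraph (Fin n)} {B X : Set (Fin n)} {x : Fin n} :
    x ∈ touched G B X ↔ IsRep G B x ∧
      ∃ v ∈ X, ∃ z, (blackGraph G B).Reachable x z ∧ (z = v ∨ G.Adj z v) := by
  simp [touched, mem_pieces]

section

variable {G : SimpleGraph (Fin n)} {B : Set (Fin n)}

theorem blackGraph_mono {B' : Set (Fin n)} (h : B ⊆ B') : blackGraph G B ≤ blackGraph G B' :=
  fun _ _ hab => ⟨hab.1, h hab.2.1, h hab.2.2⟩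

theorem mem_of_reachable_blackGraph {x y : Fin n} (h : (blackGraph G B).Reachable x y)
    (hx : x ∈ B) : y ∈ B := by
  obtain ⟨w⟩ := h
  induction w with
  | nil => exact hx
  | cons h _ ih => exact ih h.2.2

theorem eq_of_reachable_blackGraph {x y : Fin n} (h : (blackGraph G B).Reachable x y)
    (hx : x ∉ B) : y = x := by
  obtain ⟨w⟩ := h
  cases w with
  | nil => rfl
  | cons h _ => exact absurd h.2.1 hx

theorem IsRep.eq {x y : Fin n} (hx : IsRep G B x) (hy : IsRep G B y)
    (h : (blackGraph G B).Reachable x y) : x = y := by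
  rcases hx with ⟨hxB, hx⟩ | ⟨hxB, -⟩
  · rcases hy with ⟨-, hy⟩ | ⟨hyB, -⟩
    · exact le_antisymm (hx y h) (hy x h.symm)
    · exact absurd (mem_of_reachable_blackGraph h hxB) hyB
  · exact (eq_of_reachable_blackGraph h hxB).symm

theorem exists_isRep_reachable {v : Fin n} (hv : v ∈ B) :
    ∃ x, IsRep G B x ∧ (blackGraph G B).Reachable x v := by
  obtain ⟨x, hx, hmin⟩ := Set.exists_min_image {y | (blackGraph G B).Reachable v y} id
    (Set.toFinite _) ⟨v, SimpleGraph.Reachable.refl v⟩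
  exact ⟨x, Or.inl ⟨mem_of_reachable_blackGraph hx hv, fun y hy => hmin y (hx.trans hy)⟩, hx.symm⟩

/-- Every node is in a piece or, if it is gray, next to one. The implication lets a choice of
such pieces assign every representative to its own piece. -/
theorem exists_isRep_touching (v : Fin n) :
    ∃ x, IsRep G B x ∧ (IsRep G B v → x = v) ∧
      ∃ z, (blackGraph G B).Reachable x z ∧ (z = v ∨ G.Adj z v) := by
  by_cases hv : v ∈ B
  · obtain ⟨x, hx, h⟩ := exists_isRep_reachable (G := G) hv
    exact ⟨x, hx, fun hr => hx.eq hr h, v, h, Or.inl rfl⟩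
  · by_cases hg : ∃ y ∈ B, G.Adj v y
    · obtain ⟨y, hy, hvy⟩ := hg
      obtain ⟨x, hx, h⟩ := exists_isRep_reachable (G := G) hy
      refine ⟨x, hx, ?_, y, h, Or.inr hvy.symm⟩
      rintro (⟨h, -⟩ | ⟨-, h⟩)
      · exact absurd h hv
      · exact absurd hvy (h y hy)
    · push Not at hg
      exact ⟨v, Or.inr ⟨hv, hg⟩, fun _ => rfl, v, SimpleGraph.Reachable.refl v, Or.inl rfl⟩

/-- Blackening a set `X` whose nodes end up in one black component merges all pieces that
`X` touches into a single one. -/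
theorem card_pieces_union_add_card_touched {X : Set (Fin n)} {v₀ : Fin n} (hv₀ : v₀ ∈ X)
    (hX : ∀ v ∈ X, (blackGraph G (B ∪ X)).Reachable v v₀) :
    (pieces G (B ∪ X)).card + (touched G B X).card ≤ (pieces G B).card + 1 := by
  classical
  obtain ⟨x₀, hx₀, hx₀v⟩ := exists_isRep_reachable (G := G) (B := B ∪ X) (v := v₀) (Or.inr hv₀)
  -- Apart from the piece of `X`, the new pieces are old pieces that `X` does not touch.
  have hsub : pieces G (B ∪ X) ⊆ insert x₀ (pieces G B \ touched G B X) := by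
    intro x hx
    rw [mem_pieces] at hx
    rw [Finset.mem_insert, Finset.mem_sdiff, mem_pieces, mem_touched]
    by_cases hxv : (blackGraph G (B ∪ X)).Reachable x v₀
    · exact Or.inl (hx.eq hx₀ (hxv.trans hx₀v.symm))
    right
    rcases hx with ⟨hxB, hmin⟩ | ⟨hxB, hw⟩
    · have hxX : x ∉ X := fun h => hxv (hX x h)
      have hxB : x ∈ B := hxB.resolve_right hxX
      refine ⟨Or.inl ⟨hxB, fun y hy => hmin y (hy.mono (blackGraph_mono Set.subset_union_left))⟩, ?_⟩
      rintro ⟨-, v, hv, z, hz, hzv⟩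
      have hzB : z ∈ B := mem_of_reachable_blackGraph hz hxB
      have hxz := hz.mono (blackGraph_mono (G := G) (Set.subset_union_left (t := X)))
      rcases hzv with rfl | hzv
      · exact hxv (hxz.trans (hX z hv))
      · have : (blackGraph G (B ∪ X)).Adj z v := ⟨hzv, Or.inl hzB, Or.inr hv⟩
        exact hxv ((hxz.trans this.reachable).trans (hX v hv))
    · have hxB' : x ∉ B := fun h => hxB (Or.inl h)
      refine ⟨Or.inr ⟨hxB', fun y hy => hw y (Or.inl hy)⟩, ?_⟩
      rintro ⟨-, v, hv, z, hz, hzv⟩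
      obtain rfl := eq_of_reachable_blackGraph hz hxB'
      rcases hzv with rfl | hzv
      · exact hxB (Or.inr hv)
      · exact hw v (Or.inr hv) hzv
  have h1 := Finset.card_le_card hsub
  have h2 := Finset.card_insert_le x₀ (pieces G B \ touched G B X)
  have h3 : touched G B X ⊆ pieces G B := Finset.filter_subset _ _
  have h4 := Finset.card_sdiff_add_card_eq_card h3
  omega

theorem card_pieces_union_singleton_add_card_touched (v : Fin n) :
    (pieces G (B ∪ {v})).card + (touched G B {v}).card ≤ (pieces G B).card + 1 :=
  card_pieces_union_add_card_touched (v₀ := v) rfl (by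
    rintro u rfl; exact SimpleGraph.Reachable.refl _)

/-- If there are several pieces, then some two adjacent nodes touch different ones, since every node
is at distance at most one from a piece; blackening both merges these pieces. -/
theorem exists_pair_card_pieces_lt (hG : G.Connected) (h : 2 ≤ (pieces G B).card) :
    ∃ u v, (pieces G (B ∪ {u, v})).card < (pieces G B).card := by
  choose π hrep hπ z hz hzv using exists_isRep_touching (G := G) (B := B)
  obtain ⟨x, hx, y, hy, hxy⟩ := Finset.one_lt_card.1 h
  rw [mem_pieces] at hx hy
  obtain ⟨w⟩ := hG.preconnected x y
  obtain ⟨d, -, hd₁, hd₂⟩ := w.exists_boundary_dart {v | π v = x} (hπ x hx)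
    (fun h => hxy (h.symm.trans (hπ y hy)))
  refine ⟨d.fst, d.snd, ?_⟩
  have hadj : (blackGraph G (B ∪ {d.fst, d.snd})).Adj d.snd d.fst :=
    ⟨d.adj.symm, by simp, by simp⟩
  have hm := card_pieces_union_add_card_touched (G := G) (B := B) (X := {d.fst, d.snd})
    (v₀ := d.fst) (by simp) (by
      rintro v (rfl | rfl)
      · exact SimpleGraph.Reachable.refl _
      · exact hadj.reachable)
  have ht : 1 < (touched G B {d.fst, d.snd}).card := by
    refine Finset.one_lt_card.2 ⟨π d.fst, ?_, π d.snd, ?_, fun h => hd₂ (h.symm.trans hd₁)⟩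
    · exact mem_touched.2 ⟨hrep _, d.fst, by simp, _, hz _, hzv _⟩
    · exact mem_touched.2 ⟨hrep _, d.snd, by simp, _, hz _, hzv _⟩
  omega

theorem pieces_empty : pieces G ∅ = Finset.univ := by
  ext x
  simp [mem_pieces, IsRep]

theorem card_pieces_pos [NeZero n] : 0 < (pieces G B).card := by
  obtain ⟨x, hx, -⟩ := exists_isRep_touching (G := G) (B := B) 0
  exact Finset.card_pos.2 ⟨x, mem_pieces.2 hx⟩

/-- The nodes of a dominating set together touch all pieces. -/
theorem card_pieces_le_sum_card_touched {D : Finset (Fin n)}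
    (hD : ∀ v, v ∈ D ∨ ∃ u ∈ D, G.Adj u v) :
    (pieces G B).card ≤ ∑ v ∈ D, (touched G B {v}).card := by
  classical
  refine (Finset.card_le_card ?_).trans Finset.card_biUnion_le
  intro x hx
  rw [Finset.mem_biUnion]
  rcases hD x with h | ⟨u, hu, h⟩
  · exact ⟨x, h, mem_touched.2 ⟨mem_pieces.1 hx, x, rfl, x, SimpleGraph.Reachable.refl _, Or.inl rfl⟩⟩
  · exact ⟨u, hu, mem_touched.2
      ⟨mem_pieces.1 hx, u, rfl, x, SimpleGraph.Reachable.refl _, Or.inr h.symm⟩⟩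

/-- Some node of a dominating set `D` of size `d` touches at least a `d`-th part of the pieces. -/
theorem exists_card_pieces_union_singleton_add_div_le {D : Finset (Fin n)}
    (hD : ∀ v, v ∈ D ∨ ∃ u ∈ D, G.Adj u v) (hB : 0 < (pieces G B).card) :
    ∃ v, (pieces G (B ∪ {v})).card + ((pieces G B).card - 1) / D.card ≤ (pieces G B).card := by
  have hsum := card_pieces_le_sum_card_touched (B := B) hD
  have hex : ∃ v ∈ D, ((pieces G B).card - 1) / D.card < (touched G B {v}).card := by
    by_contra! hcon
    have h1 := Finset.sum_le_card_nsmul _ _ _ hcon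
    have h2 := Nat.mul_div_le ((pieces G B).card - 1) D.card
    rw [smul_eq_mul] at h1
    omega
  obtain ⟨v, -, hv⟩ := hex
  have := card_pieces_union_singleton_add_card_touched (G := G) (B := B) v
  exact ⟨v, by omega⟩

/-- If no single node reduces the number of pieces, every node touches at most one piece. -/
theorem card_pieces_le_card_of_forall_le {D : Finset (Fin n)}
    (hD : ∀ v, v ∈ D ∨ ∃ u ∈ D, G.Adj u v)
    (h : ∀ v, (pieces G B).card ≤ (pieces G (B ∪ {v})).card) : (pieces G B).card ≤ D.card := by
  refine (card_pieces_le_sum_card_touched hD).trans ?_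
  rw [Finset.card_eq_sum_ones]
  refine Finset.sum_le_sum fun v _ => ?_
  have := card_pieces_union_singleton_add_card_touched (G := G) (B := B) v
  have := h v
  omega

end

theorem reachable_induce_of_reachable_blackGraph {G : SimpleGraph (Fin n)} {B : Set (Fin n)}
    {x y : Fin n} (h : (blackGraph G B).Reachable x y) (hx : x ∈ B) (hy : y ∈ B) :
    (G.induce B).Reachable ⟨x, hx⟩ ⟨y, hy⟩ := by
  obtain ⟨w⟩ := h
  induction w with
  | nil => rfl
  | cons h _ ih =>
    have hadj : (G.induce B).Adj ⟨_, h.2.1⟩ ⟨_, h.2.2⟩ := h.1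
    exact hadj.reachable.trans (ih h.2.2 hy)

theorem reachable_blackGraph_of_reachable_induce {G : SimpleGraph (Fin n)} {B : Set (Fin n)}
    {x y : B} (h : (G.induce B).Reachable x y) : (blackGraph G B).Reachable x y := by
  obtain ⟨w⟩ := h
  induction w with
  | nil => rfl
  | cons h _ ih =>
    exact SimpleGraph.Reachable.trans
      (SimpleGraph.Adj.reachable ⟨h, Subtype.coe_prop _, Subtype.coe_prop _⟩) ih

theorem isCDS_iff {G : SimpleGraph (Fin n)} {D : Finset (Fin n)} :
    IsCDS G D ↔ (∀ v, v ∈ D ∨ ∃ u ∈ D, G.Adj u v) ∧ D.Nonempty ∧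
      ∀ u ∈ D, ∀ v ∈ D, (blackGraph G (D : Set (Fin n))).Reachable u v := by
  refine and_congr_right fun _ => ⟨fun h => ⟨?_, fun u hu v hv => ?_⟩, fun ⟨hne, h⟩ => ?_⟩
  · obtain ⟨x⟩ := h.nonempty
    exact ⟨x, x.2⟩
  · exact reachable_blackGraph_of_reachable_induce (h.preconnected ⟨u, hu⟩ ⟨v, hv⟩)
  · have : Nonempty (D : Set (Fin n)) := ⟨⟨_, hne.choose_spec⟩⟩
    exact ⟨fun u v => reachable_induce_of_reachable_blackGraph (h u u.2 v v.2) u.2 v.2⟩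

theorem isCDS_of_card_pieces_le_one {G : SimpleGraph (Fin n)} {D : Finset (Fin n)}
    (hne : D.Nonempty) (h : (pieces G (D : Set (Fin n))).card ≤ 1) : IsCDS G D := by
  rw [Finset.card_le_one] at h
  obtain ⟨x₀, hx₀⟩ := hne
  obtain ⟨r, hr, hrx₀⟩ := exists_isRep_reachable (G := G) (Finset.mem_coe.2 hx₀)
  have hrD := mem_of_reachable_blackGraph hrx₀.symm (Finset.mem_coe.2 hx₀)
  have key : ∀ v ∈ D, (blackGraph G (D : Set (Fin n))).Reachable r v := by
    intro v hv
    obtain ⟨r', hr', h'⟩ := exists_isRep_reachable (G := G) (Finset.mem_coe.2 hv)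
    rwa [h r (mem_pieces.2 hr) r' (mem_pieces.2 hr')]
  refine isCDS_iff.2 ⟨fun v => ?_, ⟨x₀, hx₀⟩, fun u hu v hv => (key u hu).symm.trans (key v hv)⟩
  by_contra! hv
  have hvr : IsRep G D v := Or.inr ⟨hv.1, fun y hy hvy => hv.2 y hy hvy.symm⟩
  exact hv.1 (h r (mem_pieces.2 hr) v (mem_pieces.2 hvr) ▸ hrD)

theorem isCDS_univ {G : SimpleGraph (Fin n)} (hG : G.Connected) : IsCDS G Finset.univ := by
  refine isCDS_iff.2 ⟨by simp, ?_, fun u _ v _ => ?_⟩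
  · obtain ⟨x⟩ := hG.nonempty
    exact ⟨x, by simp⟩
  · refine (hG.preconnected u v).mono ?_
    exact fun a b h => ⟨h, by simp, by simp⟩

theorem exists_isCDS_card_eq_minCDS {G : SimpleGraph (Fin n)} (hG : G.Connected) :
    ∃ D : Finset (Fin n), IsCDS G D ∧ D.card = minCDS G :=
  Nat.sInf_mem (s := {m | ∃ D : Finset (Fin n), IsCDS G D ∧ D.card = m})
    ⟨_, Finset.univ, isCDS_univ hG, rfl⟩

theorem IsCDS.minCDS_le {G : SimpleGraph (Fin n)} {D : Finset (Fin n)} (hD : IsCDS G D) :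
    minCDS G ≤ D.card :=
  Nat.sInf_le ⟨D, hD, rfl⟩

theorem minCDS_pos {G : SimpleGraph (Fin n)} (hG : G.Connected) : 0 < minCDS G := by
  obtain ⟨D, hD, hcard⟩ := exists_isCDS_card_eq_minCDS hG
  exact hcard ▸ Finset.card_pos.2 (isCDS_iff.1 hD).2.1

/-- Every node dominates at most `Δ + 1` nodes. -/
theorem le_maxDegree_add_one_mul_card {G : SimpleGraph (Fin n)} [DecidableRel G.Adj]
    {D : Finset (Fin n)} (hD : ∀ v, v ∈ D ∨ ∃ u ∈ D, G.Adj u v) :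
    n ≤ (G.maxDegree + 1) * D.card := by
  have hsub : Finset.univ ⊆ D.biUnion fun u => insert u (G.neighborFinset u) := by
    intro v _
    rw [Finset.mem_biUnion]
    rcases hD v with h | ⟨u, hu, h⟩
    · exact ⟨v, h, Finset.mem_insert_self _ _⟩
    · exact ⟨u, hu, Finset.mem_insert_of_mem ((G.mem_neighborFinset u v).2 h)⟩
  have h1 := Finset.card_le_card hsub
  have h2 := Finset.card_biUnion_le_card_mul D (fun u => insert u (G.neighborFinset u))
    (G.maxDegree + 1) fun u _ => (Finset.card_insert_le _ _).trans (by
      rw [G.card_neighborFinset_eq_degree]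
      exact Nat.succ_le_succ (G.degree_le_maxDegree u))
  rw [Finset.card_univ, Fintype.card_fin] at h1
  linarith [mul_comm D.card (G.maxDegree + 1)]

/-! ### What the subroutines compute -/

section

variable {G : SimpleGraph (Fin n)} [DecidableRel G.Adj]

@[simp] theorem hasNeighborT_val (B : List (Fin n)) (x : Fin n) :
    (hasNeighborT G B x).val = decide (∃ y ∈ B, G.Adj x y) := by
  simp only [hasNeighborT, anyT_val, val_tick]
  rw [Bool.eq_iff_iff]
  simp

theorem mem_componentT {B : List (Fin n)} {x y : Fin n} (hx : x ∈ B) :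
    y ∈ (componentT G B x).val ↔ (blackGraph G {z | z ∈ B}).Reachable x y := by
  set f : List (Fin n) → List (Fin n) := fun R =>
    B.filter fun y => R.any fun z => decide (y = z ∨ G.Adj y z) with hf
  have hval : (componentT G B x).val = f^[n] [x] := by
    simp [componentT, hf]
  have hmem : ∀ R y, y ∈ f R ↔ y ∈ B ∧ ∃ z ∈ R, y = z ∨ G.Adj y z := by
    intro R y
    simp [hf]
  rw [hval]
  constructor
  · suffices ∀ m, ∀ y ∈ f^[m] [x], (blackGraph G {z | z ∈ B}).Reachable x y from this n y
    intro m
    induction m with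
    | zero =>
      intro y hy
      rw [Function.iterate_zero_apply, List.mem_singleton] at hy
      exact hy ▸ SimpleGraph.Reachable.refl _
    | succ m ih =>
      intro y hy
      rw [Function.iterate_succ_apply', hmem] at hy
      obtain ⟨hyB, z, hz, rfl | hyz⟩ := hy
      · exact ih _ hz
      · have hzB := mem_of_reachable_blackGraph (ih z hz) hx
        exact (ih z hz).trans (SimpleGraph.Adj.reachable ⟨hyz.symm, hzB, hyB⟩)
  · -- A path has fewer than `n` edges, so `n` rounds reach its end.
    have hstay : ∀ m R y, y ∈ B → y ∈ R → y ∈ f^[m] R := by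
      intro m
      induction m with
      | zero => exact fun R y _ h => h
      | succ m ih => exact fun R y hy h => ih _ y hy ((hmem R y).2 ⟨hy, y, h, Or.inl rfl⟩)
    have hwalk : ∀ {u v : Fin n} (w : (blackGraph G {z | z ∈ B}).Walk u v) (m : ℕ)
        (R : List (Fin n)), w.length ≤ m → u ∈ B → u ∈ R → v ∈ f^[m] R := by
      intro u v w
      induction w with
      | nil => exact fun m R _ h1 h2 => hstay m R _ h1 h2
      | cons h p ih =>
        intro m R hm hu hR
        rw [SimpleGraph.Walk.length_cons] at hm
        obtain ⟨m, rfl⟩ : ∃ k, m = k + 1 := ⟨m - 1, by omega⟩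
        rw [Function.iterate_succ_apply]
        exact ih m (f R) (by omega) h.2.2 ((hmem _ _).2 ⟨h.2.2, _, hR, Or.inr h.1.symm⟩)
    intro h
    obtain ⟨p, hp⟩ := h.exists_isPath
    have := hp.length_lt
    rw [Fintype.card_fin] at this
    exact hwalk p n [x] this.le hx (by simp)

theorem piecesT_val (B : List (Fin n)) :
    (piecesT G B).val = (pieces G {x | x ∈ B}).card := by
  classical
  have hrep : ∀ x, (((memT x B >>= fun black => if black = true then
      componentT G B x >>= fun C => anyT (fun y => tick (decide (y < x))) C >>= fun notLowest =>
        tick (!notLowest)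
      else hasNeighborT G B x >>= fun gray => tick (!gray)) : Timed Bool).val = true) ↔
      IsRep G {x | x ∈ B} x := by
    intro x
    by_cases hx : x ∈ B
    · simp [hx, IsRep, mem_componentT]
    · simp [hx, IsRep]
  unfold piecesT
  rw [countT_val, List.countP_eq_length_filter, ← List.toFinset_card_of_nodup
    ((List.nodup_finRange n).filter _)]
  congr 1
  ext x
  rw [mem_pieces, List.mem_toFinset, List.mem_filter, ← hrep]
  simp

theorem setOf_mem_unionT (X B : List (Fin n)) :
    {x | x ∈ (unionT X B).val} = {x | x ∈ B} ∪ {x | x ∈ X} := by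
  ext x
  simp [mem_unionT, or_comm]

/-- One round of the greedy algorithm: the best of the candidate sets is added, which reduces the
number of pieces. -/
def GreedyStep (G : SimpleGraph (Fin n)) (cands : List (List (Fin n))) (B B' : List (Fin n)) :
    Prop :=
  ∃ X ∈ cands, B' = (unionT X B).val ∧
    (pieces G {x | x ∈ B'}).card < (pieces G {x | x ∈ B}).card ∧
    ∀ Y ∈ cands,
      (pieces G {x | x ∈ B'}).card ≤ (pieces G ({x | x ∈ B} ∪ {x | x ∈ Y})).card

/-- Every round removes a piece, so the fuel lasts until no candidate reduces their number. -/
theorem greedyT_spec (cands : List (List (Fin n))) (fuel : ℕ) (B : List (Fin n))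
    (h : (pieces G {x | x ∈ B}).card ≤ fuel) :
    Relation.ReflTransGen (GreedyStep G cands) B (greedyT G cands fuel B).val ∧
      ∀ Y ∈ cands, (pieces G {x | x ∈ (greedyT G cands fuel B).val}).card ≤
        (pieces G ({x | x ∈ (greedyT G cands fuel B).val} ∪ {x | x ∈ Y})).card := by
  induction fuel generalizing B with
  | zero =>
    refine ⟨Relation.ReflTransGen.refl, fun Y _ => ?_⟩
    simp only [greedyT, val_tick]
    omega
  | succ fuel ih =>
    simp only [greedyT, val_bind]
    rcases ho : (argminT (fun X => unionT X B >>= fun B' => piecesT G B') cands).val with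
      _ | ⟨X, q⟩
    · rw [argminT_val_eq_none] at ho
      subst ho
      exact ⟨Relation.ReflTransGen.refl, by simp⟩
    · obtain ⟨hX, hq, hmin⟩ := argminT_val_eq_some ho
      simp only [val_bind, piecesT_val] at hq hmin
      simp only [piecesT_val]
      split_ifs with hlt
      · simp only [val_bind]
        obtain ⟨h1, h2⟩ := ih (unionT X B).val (by omega)
        refine ⟨Relation.ReflTransGen.head ⟨X, hX, rfl, by omega, fun Y hY => ?_⟩ h1, h2⟩
        have := hmin Y hY
        rw [setOf_mem_unionT] at this
        omega
      · refine ⟨Relation.ReflTransGen.refl, fun Y hY => ?_⟩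
        have := hmin Y hY
        rw [setOf_mem_unionT] at this
        simp only [val_tick]
        omega

end

theorem GreedyStep.reflTransGen_nodup {G : SimpleGraph (Fin n)}
    {cands : List (List (Fin n))} {B B' : List (Fin n)}
    (h : Relation.ReflTransGen (GreedyStep G cands) B B') (hB : B.Nodup) : B'.Nodup := by
  induction h with
  | refl => exact hB
  | tail _ h ih =>
    obtain ⟨X, -, rfl, -⟩ := h
    exact nodup_unionT ih

theorem GreedyStep.reflTransGen_subset {G : SimpleGraph (Fin n)}
    {cands : List (List (Fin n))} {B B' : List (Fin n)}
    (h : Relation.ReflTransGen (GreedyStep G cands) B B') : B ⊆ B' := by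
  induction h with
  | refl => exact fun _ h => h
  | tail _ h ih =>
    obtain ⟨X, -, rfl, -⟩ := h
    exact fun x hx => mem_unionT.2 (Or.inr (ih hx))

theorem mem_singlesT {X : List (Fin n)} : X ∈ (singlesT n).val ↔ ∃ v, X = [v] := by
  simp [singlesT, eq_comm]

theorem mem_pairsT {X : List (Fin n)} : X ∈ (pairsT n).val ↔ ∃ u v, X = [u, v] := by
  simp [pairsT, eq_comm]

/-! ### Size of the greedy connected dominating set -/

/-- The charge for bringing `a` pieces down to none, when the optimum has size `d`: removing the
piece number `b + 1` costs `1 / max 1 (b / d)`, because a greedy round that starts with `b + 1`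
pieces removes at least `max 1 (b / d)` of them. -/
noncomputable def potential (d a : ℕ) : ℝ :=
  ∑ b ∈ Finset.range a, (1 / (max 1 (b / d) : ℕ) : ℝ)

theorem potential_mono (d : ℕ) : Monotone (potential d) := fun a b h =>
  Finset.sum_le_sum_of_subset_of_nonneg (Finset.range_mono h) fun _ _ _ => by positivity

/-- A round that starts with `a` pieces and removes at least `max 1 ((a - 1) / d)` of them pays for
one node. -/
theorem potential_add_one_le {d a a' : ℕ} (hlt : a' < a) (h : a' + (a - 1) / d ≤ a) :
    potential d a' + 1 ≤ potential d a := by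
  have hM : 0 < max 1 ((a - 1) / d) := by positivity
  have hM' : max 1 ((a - 1) / d) ≤ a - a' := by
    rw [max_le_iff]; omega
  have hsum : (a - a') • (1 / (max 1 ((a - 1) / d) : ℕ) : ℝ) ≤
      ∑ b ∈ Finset.Ico a' a, (1 / (max 1 (b / d) : ℕ) : ℝ) := by
    rw [← Nat.card_Ico]
    refine Finset.card_nsmul_le_sum _ _ _ fun b hb => ?_
    rw [Finset.mem_Ico] at hb
    refine one_div_le_one_div_of_le (by positivity) ?_
    exact_mod_cast max_le_max le_rfl (Nat.div_le_div_right (by omega))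
  have hone : (1 : ℝ) ≤ (a - a') • (1 / (max 1 ((a - 1) / d) : ℕ) : ℝ) := by
    rw [nsmul_eq_mul, mul_one_div, le_div_iff₀ (by exact_mod_cast hM), one_mul]
    exact_mod_cast hM'
  have := Finset.sum_range_add_sum_Ico (fun b => (1 / (max 1 (b / d) : ℕ) : ℝ)) hlt.le
  unfold potential
  linarith

theorem potential_of_le {d a : ℕ} (h : a ≤ d) : potential d a = a := by
  have : ∀ b ∈ Finset.range a, (1 / (max 1 (b / d) : ℕ) : ℝ) = 1 := by
    intro b hb
    rw [Finset.mem_range] at hb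
    rw [Nat.div_eq_of_lt (by omega)]
    simp
  rw [potential, Finset.sum_congr rfl this]
  simp

theorem potential_mul {d : ℕ} (hd : 0 < d) (m : ℕ) :
    potential d ((m + 1) * d) = d * (1 + (harmonic m : ℝ)) := by
  induction m with
  | zero => simp [potential_of_le]
  | succ m ih =>
    have hle : (m + 1) * d ≤ (m + 1 + 1) * d := Nat.mul_le_mul_right _ (by omega)
    have hs : ∀ b ∈ Finset.Ico ((m + 1) * d) ((m + 1 + 1) * d),
        (1 / (max 1 (b / d) : ℕ) : ℝ) = 1 / (m + 1 : ℕ) := by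
      intro b hb
      rw [Finset.mem_Ico] at hb
      rw [Nat.div_eq_of_lt_le hb.1 hb.2, max_eq_right (by omega)]
    have := Finset.sum_range_add_sum_Ico (fun b => (1 / (max 1 (b / d) : ℕ) : ℝ)) hle
    rw [Finset.sum_congr rfl hs, Finset.sum_const, Nat.card_Ico, ← Nat.sub_mul] at this
    unfold potential at ih ⊢
    rw [← this, ih, harmonic_succ]
    rw [show m + 1 + 1 - (m + 1) = 1 by omega]
    push_cast
    rw [nsmul_eq_mul, one_mul]
    field_simp
    ring

/-- In the rounds with single nodes, the number of black nodes plus the potential does not grow. -/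
theorem length_add_potential_le {G : SimpleGraph (Fin n)} {D : Finset (Fin n)}
    (hD : ∀ v, v ∈ D ∨ ∃ u ∈ D, G.Adj u v) {B B' : List (Fin n)}
    (h : Relation.ReflTransGen (GreedyStep G (singlesT n).val) B B') :
    (B'.length : ℝ) + potential D.card (pieces G {x | x ∈ B'}).card ≤
      B.length + potential D.card (pieces G {x | x ∈ B}).card := by
  induction h with
  | refl => exact le_rfl
  | @tail B₁ B₂ _ h ih =>
    obtain ⟨X, hX, rfl, hlt, hmin⟩ := h
    obtain ⟨x, rfl⟩ := mem_singlesT.1 hX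
    obtain ⟨v, hv⟩ := exists_card_pieces_union_singleton_add_div_le
      (B := {x | x ∈ B₁}) hD (by omega)
    have h1 := hmin [v] (mem_singlesT.2 ⟨v, rfl⟩)
    simp only [List.mem_singleton, Set.ofPred_eq_eq_singleton] at h1
    have h2 := potential_add_one_le (d := D.card) hlt (by omega)
    have h3 : ((unionT [x] B₁).val.length : ℝ) ≤ B₁.length + 1 := by
      exact_mod_cast length_unionT [x] B₁
    linarith

/-- In the rounds with pairs, two nodes are added for at least one piece less. -/
theorem length_add_two_mul_card_pieces_le {G : SimpleGraph (Fin n)} {B B' : List (Fin n)}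
    (h : Relation.ReflTransGen (GreedyStep G (pairsT n).val) B B') :
    B'.length + 2 * (pieces G {x | x ∈ B'}).card ≤
      B.length + 2 * (pieces G {x | x ∈ B}).card := by
  induction h with
  | refl => exact le_rfl
  | @tail B₁ B₂ _ h ih =>
    obtain ⟨X, hX, rfl, hlt, hmin⟩ := h
    obtain ⟨u, v, rfl⟩ := mem_pairsT.1 hX
    have h3 := length_unionT [u, v] B₁
    simp only [List.length_cons, List.length_nil] at h3
    omega

theorem card_pieces_le (G : SimpleGraph (Fin n)) (B : Set (Fin n)) : (pieces G B).card ≤ n := by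
  simpa using Finset.card_le_univ (pieces G B)

theorem coe_toFinset_eq_setOf (B : List (Fin n)) :
    (B.toFinset : Set (Fin n)) = {x | x ∈ B} := by
  ext x
  simp

theorem greedyCDS_val (G : SimpleGraph (Fin n)) [DecidableRel G.Adj] :
    (greedyCDS G).val =
      (greedyT G (pairsT n).val n (greedyT G (singlesT n).val n []).val).val := rfl

theorem nodup_greedyCDS (G : SimpleGraph (Fin n)) [DecidableRel G.Adj] :
    (greedyCDS G).val.Nodup := by
  rw [greedyCDS_val]
  exact GreedyStep.reflTransGen_nodup (greedyT_spec _ n _ (card_pieces_le G _)).1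
    (GreedyStep.reflTransGen_nodup (greedyT_spec _ n _ (card_pieces_le G _)).1 List.nodup_nil)

theorem isCDS_greedyCDS {G : SimpleGraph (Fin n)} [DecidableRel G.Adj] (hn : 2 ≤ n)
    (hG : G.Connected) : IsCDS G (greedyCDS G).val.toFinset := by
  rw [greedyCDS_val]
  set B := (greedyT G (singlesT n).val n []).val
  obtain ⟨-, hstuck⟩ := greedyT_spec (pairsT n).val n B (card_pieces_le G _)
  set E := (greedyT G (pairsT n).val n B).val
  have hle : (pieces G {x | x ∈ E}).card ≤ 1 := by
    by_contra! hcon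
    obtain ⟨u, v, huv⟩ := exists_pair_card_pieces_lt hG hcon
    have := hstuck [u, v] (mem_pairsT.2 ⟨u, v, rfl⟩)
    have hset : {x | x ∈ [u, v]} = ({u, v} : Set (Fin n)) := by ext; simp
    rw [hset] at this
    omega
  refine isCDS_of_card_pieces_le_one ?_ (by rwa [coe_toFinset_eq_setOf])
  rw [List.toFinset_nonempty_iff]
  intro hE
  rw [hE] at hle
  simp [pieces_empty] at hle
  omega

/-- If `p` pieces are left after the first phase, it chose at most `d (1 + H(Δ)) - p` nodes, and the
second phase adds at most `2 p`, where `p ≤ d`. -/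
theorem length_greedyCDS_le {G : SimpleGraph (Fin n)} [DecidableRel G.Adj] (hG : G.Connected) :
    ((greedyCDS G).val.length : ℝ) ≤ (2 + (harmonic G.maxDegree : ℝ)) * minCDS G := by
  obtain ⟨D, hD, hd⟩ := exists_isCDS_card_eq_minCDS hG
  rw [greedyCDS_val]
  obtain ⟨h1, hstuck⟩ := greedyT_spec (singlesT n).val n [] (card_pieces_le G _)
  set B := (greedyT G (singlesT n).val n []).val
  obtain ⟨h2, -⟩ := greedyT_spec (pairsT n).val n B (card_pieces_le G _)
  set E := (greedyT G (pairsT n).val n B).val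
  have hp : (pieces G {x | x ∈ B}).card ≤ D.card := by
    refine card_pieces_le_card_of_forall_le hD.1 fun v => ?_
    simpa using hstuck [v] (mem_singlesT.2 ⟨v, rfl⟩)
  have h3 := length_add_potential_le hD.1 h1
  rw [potential_of_le hp] at h3
  have h4 : potential D.card (pieces G {x | x ∈ ([] : List (Fin n))}).card ≤
      D.card * (1 + (harmonic G.maxDegree : ℝ)) := by
    rw [← potential_mul (hd ▸ minCDS_pos hG)]
    exact potential_mono _ ((card_pieces_le G _).trans (le_maxDegree_add_one_mul_card hD.1))
  have h5 : (E.length : ℝ) + 2 * (pieces G {x | x ∈ E}).card ≤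
      B.length + 2 * (pieces G {x | x ∈ B}).card := by
    exact_mod_cast length_add_two_mul_card_pieces_le h2
  have h6 : ((pieces G {x | x ∈ B}).card : ℝ) ≤ D.card := by exact_mod_cast hp
  have h7 : (0 : ℝ) ≤ (pieces G {x | x ∈ E}).card := by positivity
  simp only [List.length_nil, Nat.cast_zero] at h3
  rw [← hd]
  linarith

/-! ### Independent sets in unit disk graphs -/

theorem norm_sub_lt_of_abs_arg_sub_le {a b : ℂ} {r : ℝ} (ha : ‖a‖ < r) (hb : ‖b‖ < r)
    (h : |a.arg - b.arg| ≤ Real.pi / 3) : ‖a - b‖ < r := by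
  have hcos : 1 / 2 ≤ Real.cos (a.arg - b.arg) := by
    rw [← Real.cos_pi_div_three, ← Real.cos_abs (a.arg - b.arg)]
    exact Real.cos_le_cos_of_nonneg_of_le_pi (abs_nonneg _) (by linarith [Real.pi_pos]) h
  have hsq : ‖a - b‖ ^ 2 = ‖a‖ ^ 2 + ‖b‖ ^ 2 - 2 * (‖a‖ * ‖b‖) * Real.cos (a.arg - b.arg) := by
    rw [Real.cos_sub, Complex.sq_norm, Complex.normSq_apply, Complex.sub_re, Complex.sub_im,
      ← Complex.norm_mul_cos_arg a, ← Complex.norm_mul_sin_arg a, ← Complex.norm_mul_cos_arg b,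
      ← Complex.norm_mul_sin_arg b]
    linear_combination ‖a‖ ^ 2 * Real.sin_sq_add_cos_sq a.arg +
      ‖b‖ ^ 2 * Real.sin_sq_add_cos_sq b.arg
  have h0 : 0 ≤ ‖a‖ * ‖b‖ := by positivity
  have h1 : ‖a - b‖ ^ 2 ≤ ‖a‖ ^ 2 + ‖b‖ ^ 2 - ‖a‖ * ‖b‖ := by nlinarith
  have h2 : ‖a‖ ^ 2 + ‖b‖ ^ 2 - ‖a‖ * ‖b‖ < r ^ 2 := by
    have := norm_nonneg a
    have := norm_nonneg b
    rcases le_total ‖a‖ ‖b‖ with h | h <;> nlinarith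
  exact lt_of_pow_lt_pow_left₀ 2 ((norm_nonneg a).trans ha.le) (h1.trans_lt h2)

/-- An open disk of radius `r` contains at most five points at mutual distance at least `r`. -/
theorem card_le_five_of_norm_lt {ι : Type*} {s : Finset ι} {z : ι → ℂ} {r : ℝ}
    (hz : ∀ i ∈ s, ‖z i‖ < r) (hs : ∀ i ∈ s, ∀ j ∈ s, i ≠ j → r ≤ ‖z i - z j‖) : s.card ≤ 5 := by
  classical
  by_contra! hcard
  obtain ⟨i₀, hi₀⟩ : s.Nonempty := Finset.card_pos.1 (by omega)
  have hz₀ : z i₀ ≠ 0 := by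
    intro h0
    obtain ⟨j, hj, hne⟩ := Finset.exists_mem_ne (s := s) (by omega) i₀
    have := hs j hj i₀ hi₀ hne
    rw [h0, sub_zero] at this
    exact absurd (hz j hj) (not_lt.2 this)
  -- Directions are measured from that of the point `i₀`: the other directions avoid the angles up
  -- to `π / 3`, and the rest of the circle splits into four sectors of width `π / 3`.
  have hfar : ∀ i ∈ s, ∀ j ∈ s, i ≠ j → Real.pi / 3 < |(z i / z i₀).arg - (z j / z i₀).arg| := by
    intro i hi j hj hij
    by_contra! hcon
    have hpos : 0 < ‖z i₀‖ := norm_pos_iff.2 hz₀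
    have h1 : ∀ k ∈ s, ‖z k / z i₀‖ < r / ‖z i₀‖ := fun k hk => by
      rw [norm_div]; exact div_lt_div_of_pos_right (hz k hk) hpos
    have h2 := norm_sub_lt_of_abs_arg_sub_le (h1 i hi) (h1 j hj) hcon
    rw [← sub_div, norm_div, div_lt_div_iff_of_pos_right hpos] at h2
    exact absurd h2 (not_lt.2 (hs i hi j hj hij))
  have hfar₀ : ∀ i ∈ s, i ≠ i₀ → Real.pi / 3 < |(z i / z i₀).arg| := by
    intro i hi hne
    simpa [div_self hz₀] using hfar i hi i₀ hi₀ hne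
  let sector : ι → Fin 4 := fun i =>
    if (z i / z i₀).arg ≤ -(2 * Real.pi / 3) then 0
    else if (z i / z i₀).arg < 0 then 1
    else if (z i / z i₀).arg ≤ 2 * Real.pi / 3 then 2 else 3
  obtain ⟨i, hi, j, hj, hij, hsec⟩ := Finset.exists_ne_map_eq_of_card_lt_of_maps_to
    (s := s.erase i₀) (t := (Finset.univ : Finset (Fin 4))) (f := sector)
    (by rw [Finset.card_erase_of_mem hi₀, Finset.card_univ, Fintype.card_fin]; omega)
    (fun _ _ => Finset.mem_univ _)
  rw [Finset.mem_erase] at hi hj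
  have h := hfar i hi.2 j hj.2 hij
  have hi' := hfar₀ i hi.2 hi.1
  have hj' := hfar₀ j hj.2 hj.1
  have hi₁ := Complex.neg_pi_lt_arg (z i / z i₀)
  have hi₂ := Complex.arg_le_pi (z i / z i₀)
  have hj₁ := Complex.neg_pi_lt_arg (z j / z i₀)
  have hj₂ := Complex.arg_le_pi (z j / z i₀)
  simp only [sector] at hsec
  rw [lt_abs] at h hi' hj'
  have := Real.pi_pos
  split_ifs at hsec
  all_goals first
    | exact absurd hsec (by decide)
    | (rcases h with h | h <;> rcases hi' with hi' | hi' <;> rcases hj' with hj' | hj' <;> linarith)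

theorem card_le_five_of_dist_lt {ι : Type*} {s : Finset ι} {x : ι → EuclideanSpace ℝ (Fin 2)}
    {p : EuclideanSpace ℝ (Fin 2)} {r : ℝ} (hx : ∀ i ∈ s, dist (x i) p < r)
    (hs : ∀ i ∈ s, ∀ j ∈ s, i ≠ j → r ≤ dist (x i) (x j)) : s.card ≤ 5 := by
  let φ := Complex.orthonormalBasisOneI.repr.symm
  have hφ : ∀ a b, ‖φ a - φ b‖ = dist a b := fun a b => by
    rw [← map_sub, LinearIsometryEquiv.norm_map, dist_eq_norm]
  refine card_le_five_of_norm_lt (z := fun i => φ (x i) - φ p) (r := r) (fun i hi => ?_)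
    (fun i hi j hj hij => ?_)
  · rw [hφ]; exact hx i hi
  · rw [sub_sub_sub_cancel_right, hφ]; exact hs i hi j hj hij

/-- In a unit disk graph, at most five independent nodes are in a closed neighbourhood. -/
theorem IsUnitDiskGraph.card_le_five {G : SimpleGraph (Fin n)} (hG : IsUnitDiskGraph G) (v : Fin n)
    {s : Finset (Fin n)} (hv : ∀ i ∈ s, i = v ∨ G.Adj i v)
    (hs : ∀ i ∈ s, ∀ j ∈ s, ¬ G.Adj i j) : s.card ≤ 5 := by
  obtain ⟨x, r, hr, hadj⟩ := hG
  refine card_le_five_of_dist_lt (x := x) (p := x v) (r := r) (fun i hi => ?_)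
    (fun i hi j hj hij => ?_)
  · rcases hv i hi with rfl | h
    · simpa using hr
    · exact ((hadj i v).1 h).2
  · have := hs i hi j hj
    rw [hadj] at this
    push Not at this
    exact this hij

/-- In a unit disk graph, a connected dominating set of `d` nodes has at most `4 d + 1` independent
nodes in its neighbourhood: all but the first node of a connected order have an earlier neighbour
`u`, which takes one of the five places for independent nodes around them. -/
theorem IsUnitDiskGraph.card_independent_le {G : SimpleGraph (Fin n)} (hG : IsUnitDiskGraph G)
    {D I : Finset (Fin n)} (hD : IsCDS G D) (hI : ∀ i ∈ I, ∀ j ∈ I, ¬ G.Adj i j) :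
    I.card ≤ 4 * D.card + 1 := by
  classical
  obtain ⟨hdom, ⟨x₀, hx₀⟩, hconn⟩ := isCDS_iff.1 hD
  let N : Finset (Fin n) → Finset (Fin n) := fun A => I.filter fun i => ∃ u ∈ A, i = u ∨ G.Adj i u
  have hsmall : ∀ (v : Fin n) (s : Finset (Fin n)), s ⊆ I → (∀ i ∈ s, i = v ∨ G.Adj i v) →
      s.card ≤ 5 := fun v s hs hv =>
    hG.card_le_five v hv fun i hi j hj => hI i (hs hi) j (hs hj)
  -- A largest subset `A` of `D` that satisfies the bound is all of `D`, since a node of `D` next to `A`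
  -- could be added to it.
  let good : Finset (Finset (Fin n)) :=
    D.powerset.filter fun A => x₀ ∈ A ∧ (N A).card ≤ 4 * A.card + 1
  have hgood : good.Nonempty := by
    refine ⟨{x₀}, Finset.mem_filter.2 ⟨by simpa using hx₀, by simp, ?_⟩⟩
    refine (hsmall x₀ _ (Finset.filter_subset _ _) fun i hi => ?_).trans (by simp)
    simpa using (Finset.mem_filter.1 hi).2
  obtain ⟨A, hA, hmax⟩ := Finset.exists_max_image good Finset.card hgood
  obtain ⟨hAD, hxA, hNA⟩ := Finset.mem_filter.1 hA
  rw [Finset.mem_powerset] at hAD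
  have hADeq : A = D := by
    by_contra hne
    obtain ⟨y, hyD, hyA⟩ : ∃ y ∈ D, y ∉ A := by
      by_contra! hcon
      exact hne (Finset.Subset.antisymm hAD hcon)
    obtain ⟨w⟩ := hconn x₀ hx₀ y hyD
    obtain ⟨⟨⟨u, v⟩, huv⟩, -, huA, hvA⟩ := w.exists_boundary_dart (A : Set (Fin n)) hxA hyA
    simp only [Finset.mem_coe] at huA hvA
    obtain ⟨huv, -, hvD⟩ := huv
    have hnew : (N {v} \ N A).card ≤ 4 := by
      have hins : (insert u (N {v} \ N A)).card ≤ 5 := by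
        refine hG.card_le_five v (fun i hi => ?_) (fun i hi j hj => ?_)
        · rcases Finset.mem_insert.1 hi with rfl | hi
          · exact Or.inr huv
          · simpa using (Finset.mem_filter.1 (Finset.mem_sdiff.1 hi).1).2
        · have hu : ∀ i ∈ N {v} \ N A, ¬ G.Adj i u := fun i hi hiu =>
            (Finset.mem_sdiff.1 hi).2 (Finset.mem_filter.2
              ⟨(Finset.mem_filter.1 (Finset.mem_sdiff.1 hi).1).1, u, huA, Or.inr hiu⟩)
          rcases Finset.mem_insert.1 hi with rfl | hi' <;>
            rcases Finset.mem_insert.1 hj with rfl | hj'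
          · exact G.loopless.irrefl _
          · exact fun h => hu j hj' h.symm
          · exact hu i hi'
          · exact hI i (Finset.mem_filter.1 (Finset.mem_sdiff.1 hi').1).1
              j (Finset.mem_filter.1 (Finset.mem_sdiff.1 hj').1).1
      rw [Finset.card_insert_of_notMem] at hins
      · omega
      · intro hu
        obtain ⟨h1, h2⟩ := Finset.mem_sdiff.1 hu
        exact h2 (Finset.mem_filter.2 ⟨(Finset.mem_filter.1 h1).1, u, huA, Or.inl rfl⟩)
    have hsub : N (insert v A) ⊆ N A ∪ (N {v} \ N A) := by
      intro i hi
      rw [Finset.union_sdiff_self_eq_union, Finset.mem_union]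
      obtain ⟨hiI, w, hw, hiw⟩ := Finset.mem_filter.1 hi
      rcases Finset.mem_insert.1 hw with rfl | hw
      · exact Or.inr (Finset.mem_filter.2 ⟨hiI, w, by simp, hiw⟩)
      · exact Or.inl (Finset.mem_filter.2 ⟨hiI, w, hw, hiw⟩)
    have h1 := (Finset.card_le_card hsub).trans (Finset.card_union_le _ _)
    have h2 : (insert v A).card = A.card + 1 := Finset.card_insert_of_notMem hvA
    have h3 := hmax (insert v A) (Finset.mem_filter.2 ⟨Finset.mem_powerset.2
      (Finset.insert_subset hvD hAD), Finset.mem_insert_of_mem hxA, by omega⟩)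
    omega
  rw [hADeq] at hNA
  refine (Finset.card_le_card fun i hi => ?_).trans hNA
  refine Finset.mem_filter.2 ⟨hi, ?_⟩
  rcases hdom i with h | ⟨u, hu, h⟩
  · exact ⟨i, h, Or.inl rfl⟩
  · exact ⟨u, hu, Or.inr h.symm⟩

/-! ### Size of the connected dominating set in a unit disk graph -/

/-- `x` is at distance exactly two from the set `I`. -/
def AtDistanceTwo (G : SimpleGraph (Fin n)) (I : List (Fin n)) (x : Fin n) : Prop :=
  x ∉ I ∧ (∀ z ∈ I, ¬ G.Adj x z) ∧ ∃ y, G.Adj x y ∧ ∃ z ∈ I, G.Adj y z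

/-- The sets that arise from `{r}` by adding nodes at distance exactly two. -/
inductive GrownFrom (G : SimpleGraph (Fin n)) (r : Fin n) : List (Fin n) → Prop
  | base : GrownFrom G r [r]
  | step {I : List (Fin n)} {x : Fin n} :
      GrownFrom G r I → AtDistanceTwo G I x → GrownFrom G r (x :: I)

namespace GrownFrom

variable {G : SimpleGraph (Fin n)} {r : Fin n} {I : List (Fin n)}

theorem root_mem (h : GrownFrom G r I) : r ∈ I := by
  induction h with
  | base => simp
  | step _ _ ih => exact List.mem_cons_of_mem _ ih

theorem nodup (h : GrownFrom G r I) : I.Nodup := by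
  induction h with
  | base => simp
  | step _ hx ih => exact List.nodup_cons.2 ⟨hx.1, ih⟩

theorem not_adj (h : GrownFrom G r I) : ∀ i ∈ I, ∀ j ∈ I, ¬ G.Adj i j := by
  induction h with
  | base => simp
  | step _ hx ih =>
    intro i hi j hj
    rcases List.mem_cons.1 hi with rfl | hi' <;> rcases List.mem_cons.1 hj with rfl | hj'
    · exact G.loopless.irrefl _
    · exact hx.2.1 j hj'
    · exact fun h => hx.2.1 i hi' h.symm
    · exact ih i hi' j hj'

/-- If no node touches two pieces, all of `I` is in a single one, since a middle node between two
nodes of `I` touches the pieces of both. -/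
theorem reachable (h : GrownFrom G r I) {B : Set (Fin n)} (hIB : ∀ x ∈ I, x ∈ B)
    (hB : ∀ v, (touched G B {v}).card ≤ 1) : ∀ x ∈ I, (blackGraph G B).Reachable r x := by
  induction h with
  | base => simp
  | step hI hx ih =>
    have ih := ih fun z hz => hIB z (List.mem_cons_of_mem _ hz)
    intro w hw
    rcases List.mem_cons.1 hw with rfl | hw
    · obtain ⟨-, -, y, hxy, z, hz, hyz⟩ := hx
      obtain ⟨a, ha, haw⟩ := exists_isRep_reachable (G := G) (hIB w (by simp))
      obtain ⟨b, hb, hbz⟩ := exists_isRep_reachable (G := G) (hIB z (List.mem_cons_of_mem _ hz))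
      have := Finset.card_le_one.1 (hB y) a (mem_touched.2 ⟨ha, y, rfl, w, haw, Or.inr hxy⟩)
        b (mem_touched.2 ⟨hb, y, rfl, z, hbz, Or.inr hyz.symm⟩)
      subst this
      exact (ih z hz).trans (hbz.symm.trans haw)
    · exact ih w hw

theorem card_pieces_le_one (h : GrownFrom G r I) (hdom : ∀ x, x ∈ I ∨ ∃ z ∈ I, G.Adj x z)
    {B : Set (Fin n)} (hIB : ∀ x ∈ I, x ∈ B) (hB : ∀ v, (touched G B {v}).card ≤ 1) :
    (pieces G B).card ≤ 1 := by
  have key : ∀ x ∈ pieces G B, (blackGraph G B).Reachable r x := by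
    intro x hx
    rcases mem_pieces.1 hx with ⟨hxB, -⟩ | ⟨hxB, hw⟩
    · rcases hdom x with hxI | ⟨z, hz, hxz⟩
      · exact h.reachable hIB hB x hxI
      · exact (h.reachable hIB hB z hz).trans
          (SimpleGraph.Adj.reachable ⟨hxz.symm, hIB z hz, hxB⟩)
    · rcases hdom x with hxI | ⟨z, hz, hxz⟩
      · exact absurd (hIB x hxI) hxB
      · exact absurd hxz (hw z (hIB z hz))
  exact Finset.card_le_one.2 fun x hx y hy =>
    (mem_pieces.1 hx).eq (mem_pieces.1 hy) ((key x hx).symm.trans (key y hy))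

end GrownFrom

theorem dominating_of_forall_not_atDistanceTwo {G : SimpleGraph (Fin n)} (hG : G.Connected)
    {r : Fin n} {I : List (Fin n)} (hr : r ∈ I) (h : ∀ x, ¬ AtDistanceTwo G I x) (x : Fin n) :
    x ∈ I ∨ ∃ z ∈ I, G.Adj x z := by
  by_contra hx
  obtain ⟨w⟩ := hG.preconnected r x
  obtain ⟨d, -, hd₁, hd₂⟩ := w.exists_boundary_dart {x | x ∈ I ∨ ∃ z ∈ I, G.Adj x z}
    (Or.inl hr) hx
  have hd₂ : ¬ (d.snd ∈ I ∨ ∃ z ∈ I, G.Adj d.snd z) := hd₂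
  push Not at hd₂
  refine h d.snd ⟨hd₂.1, hd₂.2, d.fst, d.adj.symm, ?_⟩
  rcases hd₁ with hd₁ | hd₁
  · exact absurd d.adj.symm (hd₂.2 _ hd₁)
  · exact hd₁

section

variable {G : SimpleGraph (Fin n)} [DecidableRel G.Adj]

/-- Every round adds a node, so the fuel lasts until there is no node at distance two any more. -/
theorem extendMIS_spec {r : Fin n} (fuel : ℕ) {I : List (Fin n)} (hI : GrownFrom G r I)
    (hfuel : n < fuel + I.length) :
    GrownFrom G r (extendMIS G fuel I).val ∧ ∀ x, ¬ AtDistanceTwo G (extendMIS G fuel I).val x := by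
  induction fuel generalizing I with
  | zero =>
    have := length_le_of_nodup hI.nodup
    omega
  | succ fuel ih =>
    simp only [extendMIS, val_bind]
    rcases ho : (findT (fun x => memT x I >>= fun a => hasNeighborT G I x >>= fun b =>
      anyT (fun y => hasNeighborT G I y >>= fun e => tick (decide (G.Adj x y) && e))
        (List.finRange n) >>= fun d => tick (!a && !b && d)) (List.finRange n)).val with _ | x
    · refine ⟨hI, fun x (hx : AtDistanceTwo G I x) => ?_⟩
      rw [findT_val, List.find?_eq_none] at ho
      have := ho x (List.mem_finRange x)
      obtain ⟨h1, h2, y, hxy, z, hz, hyz⟩ := hx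
      simp [h1] at this
      obtain ⟨z', hz', h'⟩ := this h2 y hxy z hz hyz
    · rw [findT_val] at ho
      have := List.find?_some ho
      simp at this
      refine ih (GrownFrom.step hI ⟨this.1.1, this.1.2, this.2⟩) ?_
      rw [List.length_cons]
      omega

theorem misCDS_val {r : Fin n} {l : List (Fin n)} (h : List.finRange n = r :: l) :
    (misCDS G).val = (greedyT G (singlesT n).val n (extendMIS G n [r]).val).val := by
  unfold misCDS
  rw [h]
  rfl

end

theorem card_pieces_le_length {G : SimpleGraph (Fin n)} {I : List (Fin n)} (hI : I.Nodup)
    (hdom : ∀ x, x ∈ I ∨ ∃ z ∈ I, G.Adj x z) : (pieces G {x | x ∈ I}).card ≤ I.length := by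
  rw [← List.toFinset_card_of_nodup hI]
  refine Finset.card_le_card fun x hx => ?_
  rw [List.mem_toFinset]
  rcases mem_pieces.1 hx with ⟨h, -⟩ | ⟨-, h⟩
  · exact h
  · rcases hdom x with h' | ⟨z, hz, hxz⟩
    · exact h'
    · exact absurd hxz (h z hz)

theorem exists_finRange_eq_cons (hn : 0 < n) : ∃ r l, List.finRange n = r :: l := by
  obtain ⟨m, rfl⟩ : ∃ m, n = m + 1 := ⟨n - 1, by omega⟩
  exact ⟨_, _, List.finRange_succ⟩

section

variable {G : SimpleGraph (Fin n)} [DecidableRel G.Adj]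

theorem nodup_misCDS (hn : 0 < n) : (misCDS G).val.Nodup := by
  obtain ⟨r, l, hrl⟩ := exists_finRange_eq_cons hn
  rw [misCDS_val hrl]
  exact GreedyStep.reflTransGen_nodup (greedyT_spec _ n _ (card_pieces_le G _)).1
    (extendMIS_spec n GrownFrom.base (by simp)).1.nodup

theorem isCDS_misCDS (hG : G.Connected) (hn : 0 < n) : IsCDS G (misCDS G).val.toFinset := by
  obtain ⟨r, l, hrl⟩ := exists_finRange_eq_cons hn
  rw [misCDS_val hrl]
  obtain ⟨hI, hmax⟩ := extendMIS_spec (G := G) (r := r) n GrownFrom.base (by simp)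
  set I := (extendMIS G n [r]).val
  obtain ⟨hsteps, hstuck⟩ := greedyT_spec (singlesT n).val n I (card_pieces_le G _)
  set B := (greedyT G (singlesT n).val n I).val
  have hIB := GreedyStep.reflTransGen_subset hsteps
  refine isCDS_of_card_pieces_le_one ⟨r, by simpa using hIB hI.root_mem⟩ ?_
  rw [coe_toFinset_eq_setOf]
  refine hI.card_pieces_le_one (dominating_of_forall_not_atDistanceTwo hG hI.root_mem hmax)
    (fun x hx => hIB hx) fun v => ?_
  have h1 := hstuck [v] (mem_singlesT.2 ⟨v, rfl⟩)
  simp only [List.mem_singleton, Set.ofPred_eq_eq_singleton] at h1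
  have h2 := card_pieces_union_singleton_add_card_touched (G := G) (B := {x | x ∈ B}) v
  omega

/-- The independent set has at most `4 d + 1` nodes, and connecting it costs at most
`d (1 + H(3)) + 1 / 4 - 1` further ones. -/
theorem length_misCDS_le (hudg : IsUnitDiskGraph G) (hG : G.Connected) (hn : 0 < n) :
    ((misCDS G).val.length : ℝ) ≤ 7.3 * minCDS G := by
  obtain ⟨D, hD, hd⟩ := exists_isCDS_card_eq_minCDS hG
  obtain ⟨r, l, hrl⟩ := exists_finRange_eq_cons hn
  rw [misCDS_val hrl]
  obtain ⟨hI, hmax⟩ := extendMIS_spec (G := G) (r := r) n GrownFrom.base (by simp)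
  set I := (extendMIS G n [r]).val
  obtain ⟨hsteps, -⟩ := greedyT_spec (singlesT n).val n I (card_pieces_le G _)
  set B := (greedyT G (singlesT n).val n I).val
  have hdpos : 0 < D.card := hd ▸ minCDS_pos hG
  have hIlen : I.length ≤ 4 * D.card + 1 := by
    rw [← List.toFinset_card_of_nodup hI.nodup]
    exact hudg.card_independent_le hD fun i hi j hj =>
      hI.not_adj i (List.mem_toFinset.1 hi) j (List.mem_toFinset.1 hj)
  have h1 := length_add_potential_le hD.1 hsteps
  have h2 : potential D.card (pieces G {x | x ∈ I}).card ≤ potential D.card (4 * D.card + 1) :=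
    potential_mono _ ((card_pieces_le_length hI.nodup
      (dominating_of_forall_not_atDistanceTwo hG hI.root_mem hmax)).trans hIlen)
  have h3 : potential D.card (4 * D.card + 1) = D.card * (1 + 11 / 6) + 1 / 4 := by
    have h4 : potential D.card (4 * D.card) = _ := potential_mul hdpos 3
    have h5 : (harmonic 3 : ℝ) = 11 / 6 := by
      norm_num [harmonic, Finset.sum_range_succ]
    rw [h5] at h4
    rw [← h4, potential, Finset.sum_range_succ, Nat.mul_div_cancel _ hdpos]
    norm_num [potential]
  have h4 : 1 ≤ potential D.card (pieces G {x | x ∈ B}).card := by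
    have : NeZero n := ⟨hn.ne'⟩
    rw [← Nat.cast_one, ← potential_of_le (show 1 ≤ D.card from hdpos)]
    exact potential_mono _ card_pieces_pos
  have h5 : (I.length : ℝ) ≤ 4 * D.card + 1 := by exact_mod_cast hIlen
  have h6 : (1 : ℝ) ≤ D.card := by exact_mod_cast hdpos
  rw [← hd]
  linarith

end

/-! ### Lower bounds on the number of messages -/

/-- The nodes that transmit the rumor `s` in some message of the schedule. -/
def sendersOf (s : Fin n) (σ : List (Msg n)) : Finset (Fin n) :=
  ((σ.filter fun m => decide (s ∈ m.2)).map Prod.fst).toFinset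

theorem mem_sendersOf {s u : Fin n} {σ : List (Msg n)} :
    u ∈ sendersOf s σ ↔ ∃ b, (u, b) ∈ σ ∧ s ∈ b := by
  simp [sendersOf]

section

variable {G : SimpleGraph (Fin n)}

theorem knowledgeAfter_cons (K : Knowledge n) (m : Msg n) (σ : List (Msg n)) :
    knowledgeAfter G K (m :: σ) = knowledgeAfter G (deliver G K m) σ := rfl

theorem knowledgeAfter_append (K : Knowledge n) (σ τ : List (Msg n)) :
    knowledgeAfter G K (σ ++ τ) = knowledgeAfter G (knowledgeAfter G K σ) τ := by
  simp [knowledgeAfter]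

theorem feasible_append {c : ℕ} {K : Knowledge n} {σ τ : List (Msg n)} :
    Feasible G c K (σ ++ τ) ↔ Feasible G c K σ ∧ Feasible G c (knowledgeAfter G K σ) τ := by
  induction σ generalizing K with
  | nil => simp [Feasible, knowledgeAfter]
  | cons m σ ih => simp [Feasible, knowledgeAfter_cons, ih, and_assoc]

/-- Where a rumor `s` can be after the nodes of `A` have transmitted it: next to a node of `A` or at
`s`, and the set `A` is connected and contains `s` unless it is empty. -/
structure SpreadBy (G : SimpleGraph (Fin n)) (s : Fin n) (K : Knowledge n) (A : Set (Fin n)) :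
    Prop where
  known : ∀ v, s ∈ K v → v = s ∨ ∃ u ∈ A, G.Adj u v
  reach : ∀ u ∈ A, s ∈ A ∧ (blackGraph G A).Reachable s u

theorem SpreadBy.deliver {s : Fin n} {K : Knowledge n} {A : Set (Fin n)} (h : SpreadBy G s K A)
    {m : Msg n} (hm : ∀ x ∈ m.2, x ∈ K m.1) :
    SpreadBy G s (deliver G K m) (A ∪ {u | u = m.1 ∧ s ∈ m.2}) := by
  refine ⟨fun v hv => ?_, fun u hu => ?_⟩
  · rcases hv with hv | ⟨hadj, hs⟩
    · rcases h.known v hv with h | ⟨u, hu, huv⟩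
      · exact Or.inl h
      · exact Or.inr ⟨u, Or.inl hu, huv⟩
    · exact Or.inr ⟨m.1, Or.inr ⟨rfl, hs⟩, hadj⟩
  · have hmono : blackGraph G A ≤ blackGraph G (A ∪ {u | u = m.1 ∧ s ∈ m.2}) :=
      blackGraph_mono Set.subset_union_left
    rcases hu with hu | ⟨rfl, hs⟩
    · exact ⟨Or.inl (h.reach u hu).1, (h.reach u hu).2.mono hmono⟩
    · rcases h.known _ (hm s hs) with h' | ⟨u, hu, huv⟩
      · exact ⟨Or.inr ⟨h'.symm, hs⟩, h' ▸ SimpleGraph.Reachable.refl _⟩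
      · refine ⟨Or.inl (h.reach u hu).1, ((h.reach u hu).2.mono hmono).trans ?_⟩
        exact SimpleGraph.Adj.reachable ⟨huv, Or.inl hu, Or.inr ⟨rfl, hs⟩⟩

theorem SpreadBy.knowledgeAfter {s : Fin n} {c : ℕ} {σ : List (Msg n)} {K : Knowledge n}
    {A : Set (Fin n)} (h : SpreadBy G s K A) (hσ : Feasible G c K σ) :
    SpreadBy G s (knowledgeAfter G K σ) (A ∪ {u | u ∈ sendersOf s σ}) := by
  induction σ generalizing K A with
  | nil => simpa [MultiBroadcast.knowledgeAfter, sendersOf] using h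
  | cons m σ ih =>
    have := ih (h.deliver hσ.1.2) hσ.2
    rw [knowledgeAfter_cons]
    convert this using 1
    ext u
    simp only [Set.mem_union, Set.mem_ofPred_eq, mem_sendersOf, List.mem_cons, or_assoc]
    refine or_congr_right ⟨?_, ?_⟩
    · rintro ⟨b, rfl | h, hs⟩
      · exact Or.inl ⟨rfl, hs⟩
      · exact Or.inr ⟨b, h, hs⟩
    · rintro (⟨rfl, hs⟩ | ⟨b, h, hs⟩)
      · exact ⟨m.2, Or.inl rfl, hs⟩
      · exact ⟨b, Or.inr h, hs⟩

/-- The transmitters of any one rumor form a connected dominating set that contains its source. -/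
theorem IsMultiBroadcast.isCDS_sendersOf {S : Finset (Fin n)} {c : ℕ} {σ : List (Msg n)}
    (hσ : IsMultiBroadcast G S c σ) (hn : 2 ≤ n) {s : Fin n} (hs : s ∈ S) :
    s ∈ sendersOf s σ ∧ IsCDS G (sendersOf s σ) := by
  have h₀ : SpreadBy G s (initialKnowledge S) ∅ :=
    ⟨fun v hv => Or.inl hv.1.symm, fun u hu => absurd hu (Set.notMem_empty u)⟩
  have h := h₀.knowledgeAfter hσ.1
  rw [Set.empty_union] at h
  have hcoe : {u | u ∈ sendersOf s σ} = (sendersOf s σ : Set (Fin n)) := rfl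
  rw [hcoe] at h
  have hknown := fun v => h.known v (hσ.2 v s hs)
  -- Some node other than `s` has to learn the rumor, so there is a transmitter.
  have : Nontrivial (Fin n) := Fin.nontrivial_iff_two_le.2 hn
  obtain ⟨v, hv⟩ := exists_ne s
  obtain ⟨u, hu, -⟩ := (hknown v).resolve_left hv
  have hsA := (h.reach u hu).1
  refine ⟨hsA, isCDS_iff.2 ⟨fun v => ?_, ⟨s, hsA⟩, fun a ha b hb =>
    (h.reach a ha).2.symm.trans (h.reach b hb).2⟩⟩
  rcases hknown v with rfl | h'
  · exact Or.inl hsA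
  · exact Or.inr h'

theorem card_sendersOf_le (s : Fin n) (σ : List (Msg n)) :
    (sendersOf s σ).card ≤ σ.countP fun m => decide (s ∈ m.2) := by
  refine (List.toFinset_card_le _).trans ?_
  rw [List.length_map, List.countP_eq_length_filter]

theorem sum_countP_le {S : Finset (Fin n)} {c : ℕ} {K : Knowledge n} {σ : List (Msg n)}
    (hσ : Feasible G c K σ) :
    ∑ s ∈ S, σ.countP (fun m => decide (s ∈ m.2)) ≤ c * σ.length := by
  induction σ generalizing K with
  | nil => simp
  | cons m σ ih =>
    have h1 := ih hσ.2
    have h2 : ∑ s ∈ S, (if s ∈ m.2 then 1 else 0) ≤ c := by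
      rw [← Finset.card_filter]
      refine (Finset.card_le_card (t := m.2.toFinset) fun s hs => ?_).trans
        ((List.toFinset_card_le _).trans hσ.1.1)
      exact List.mem_toFinset.2 (Finset.mem_filter.1 hs).2
    simp only [List.countP_cons, decide_eq_true_eq, List.length_cons, Finset.sum_add_distrib]
    linarith

theorem IsMultiBroadcast.card_mul_minCDS_le {S : Finset (Fin n)} {c : ℕ} {σ : List (Msg n)}
    (hσ : IsMultiBroadcast G S c σ) (hn : 2 ≤ n) : S.card * minCDS G ≤ c * σ.length := by
  refine le_trans ?_ (sum_countP_le (S := S) hσ.1)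
  rw [← smul_eq_mul]
  exact Finset.card_nsmul_le_sum _ _ _ fun s hs =>
    (hσ.isCDS_sendersOf hn hs).2.minCDS_le.trans (card_sendersOf_le s σ)

theorem IsMultiBroadcast.card_le_length {S : Finset (Fin n)} {c : ℕ} {σ : List (Msg n)}
    (hσ : IsMultiBroadcast G S c σ) (hn : 2 ≤ n) : S.card ≤ σ.length := by
  refine (Finset.card_le_card (t := (σ.map Prod.fst).toFinset) fun s hs => ?_).trans
    ((List.toFinset_card_le _).trans (by rw [List.length_map]))
  obtain ⟨b, hb, -⟩ := mem_sendersOf.1 (hσ.isCDS_sendersOf hn hs).1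
  exact List.mem_toFinset.2 (List.mem_map.2 ⟨_, hb, rfl⟩)

theorem IsMultiBroadcast.exists_length_eq_mOpt {S : Finset (Fin n)} {c : ℕ} {σ : List (Msg n)}
    (hσ : IsMultiBroadcast G S c σ) :
    ∃ τ : List (Msg n), IsMultiBroadcast G S c τ ∧ τ.length = mOpt G S c :=
  Nat.sInf_mem (s := {m | ∃ σ : List (Msg n), IsMultiBroadcast G S c σ ∧ σ.length = m})
    ⟨_, σ, hσ, rfl⟩

end

/-! ### Correctness of the multi-broadcast algorithm -/

/-- All batches but the first have exactly `c` rumors. -/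
theorem batchesT_spec {c : ℕ} (hc : 1 ≤ c) (l : List (Fin n)) :
    (batchesT c l).val.flatten = l ∧ (∀ b ∈ (batchesT c l).val, b.length ≤ c) ∧
      ((batchesT c l).val = [] ∨ ∃ b bs, (batchesT c l).val = b :: bs ∧ 1 ≤ b.length ∧
        l.length = b.length + bs.length * c) := by
  induction l with
  | nil => simp [batchesT]
  | cons s l ih =>
    obtain ⟨h1, h2, h3⟩ := ih
    simp only [batchesT, val_bind]
    rcases hb : (batchesT c l).val with _ | ⟨b, bs⟩
    · rw [hb] at h1
      simp only [List.flatten_nil] at h1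
      subst h1
      refine ⟨rfl, by simpa using hc, Or.inr ⟨[s], [], rfl, by simp⟩⟩
    · rw [hb] at h1 h2 h3
      obtain ⟨b', bs', heq, hb1, hlen⟩ := h3.resolve_left (by simp)
      obtain ⟨rfl, rfl⟩ := List.cons.inj heq
      have hbc := h2 b (by simp)
      simp only [val_bind, lengthT_val, val_tick]
      split_ifs with hlt
      · refine ⟨by simp [← h1], ?_, Or.inr ⟨_, _, rfl, by simp, ?_⟩⟩
        · intro x hx
          rcases List.mem_cons.1 hx with rfl | hx
          · simpa using hlt
          · exact h2 x (List.mem_cons_of_mem _ hx)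
        · simp only [List.length_cons]; omega
      · refine ⟨by simp [← h1], ?_, Or.inr ⟨_, _, rfl, by simp, ?_⟩⟩
        · intro x hx
          rcases List.mem_cons.1 hx with rfl | hx
          · simpa using hc
          · exact h2 x hx
        · simp only [List.length_cons, List.length_nil]
          have : b.length = c := by omega
          rw [add_mul]
          omega

theorem length_batchesT_le {c : ℕ} (hc : 1 ≤ c) {l : List (Fin n)} {k : ℕ} (hl : l.length ≤ k) :
    (batchesT c l).val.length ≤ (k + c - 1) / c := by
  rw [Nat.le_div_iff_mul_le (by omega)]
  rcases (batchesT_spec hc l).2.2 with h | ⟨b, bs, h, hb, hlen⟩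
  · simp [h]
  · rw [h, List.length_cons, add_mul]
    omega

section

variable {G : SimpleGraph (Fin n)}

theorem subset_knowledgeAfter (K : Knowledge n) (σ : List (Msg n)) (v : Fin n) :
    K v ⊆ knowledgeAfter G K σ v := by
  induction σ generalizing K with
  | nil => exact subset_rfl
  | cons m σ ih => exact Set.subset_union_left.trans (ih (deliver G K m))

/-- A node may send batches of rumors that it knows, and its neighbours then know them. -/
theorem feasible_map_send {c : ℕ} {v : Fin n} {bs : List (List (Fin n))} {K : Knowledge n}
    (hc : ∀ b ∈ bs, b.length ≤ c) (hK : ∀ b ∈ bs, ∀ s ∈ b, s ∈ K v) :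
    Feasible G c K (bs.map fun b => (v, b)) ∧ ∀ w, G.Adj v w → ∀ b ∈ bs, ∀ s ∈ b,
      s ∈ knowledgeAfter G K (bs.map fun b => (v, b)) w := by
  induction bs generalizing K with
  | nil => simp [Feasible]
  | cons b bs ih =>
    obtain ⟨h1, h2⟩ := ih (K := deliver G K (v, b))
      (fun x hx => hc x (List.mem_cons_of_mem _ hx))
      (fun x hx s hs => Or.inl (hK x (List.mem_cons_of_mem _ hx) s hs))
    refine ⟨⟨⟨hc b (by simp), hK b (by simp)⟩, h1⟩, fun w hw x hx s hs => ?_⟩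
    rw [List.map_cons, knowledgeAfter_cons]
    rcases List.mem_cons.1 hx with rfl | hx
    · exact subset_knowledgeAfter _ _ _ (Or.inr ⟨hw, hs⟩)
    · exact h2 w hw x hx s hs

/-- A list of pairs `(node, parent)`, latest node first, is a tree in `G` with root `r`. -/
inductive RootedTree (G : SimpleGraph (Fin n)) (r : Fin n) : List (Fin n × Fin n) → Prop
  | root : RootedTree G r [(r, r)]
  | grow {T : List (Fin n × Fin n)} {v p : Fin n} : RootedTree G r T → v ∉ T.map Prod.fst →
      p ∈ T.map Prod.fst → G.Adj p v → RootedTree G r ((v, p) :: T)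

namespace RootedTree

variable {r : Fin n} {T : List (Fin n × Fin n)}

theorem root_mem (h : RootedTree G r T) : r ∈ T.map Prod.fst := by
  induction h with
  | root => simp
  | grow _ _ _ _ ih => exact List.mem_cons_of_mem _ ih

theorem nodup (h : RootedTree G r T) : (T.map Prod.fst).Nodup := by
  induction h with
  | root => simp
  | grow _ hv _ _ ih => exact List.nodup_cons.2 ⟨hv, ih⟩

theorem length_le (h : RootedTree G r T) : T.length ≤ n := by
  simpa using length_le_of_nodup h.nodup

/-- Convergecast: the root learns all rumors that are held in the tree, and every other node sends at
most `⌈k / c⌉` messages. -/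
theorem collectT_spec (hT : RootedTree G r T) {c k : ℕ} (hc : 1 ≤ c) {K : Knowledge n}
    {h : List (Fin n × Fin n)} (hk : h.length ≤ k)
    (hh : ∀ x ∈ h, x.1 ∈ T.map Prod.fst ∧ x.2 ∈ K x.1) :
    Feasible G c K (collectT c T h).val ∧
      (∀ x ∈ h, x.2 ∈ knowledgeAfter G K (collectT c T h).val r) ∧
      (collectT c T h).val.length ≤ (T.length - 1) * ((k + c - 1) / c) := by
  induction hT generalizing K h with
  | root =>
    simp only [collectT, if_true, val_tick, List.length_nil]
    refine ⟨trivial, fun x hx => ?_, Nat.zero_le _⟩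
    obtain ⟨h1, h2⟩ := hh x hx
    simp only [List.map_cons, List.map_nil, List.mem_singleton] at h1
    exact h1 ▸ h2
  | @grow T v p hT hv hp hadj ih =>
    have hvp : v ≠ p := fun h => hv (h ▸ hp)
    simp only [collectT, if_neg hvp, val_bind, filterT_val, mapT_val, val_tick, appendT_val]
    set rumors := (h.filter fun x => decide (x.1 = v)).map fun x => x.2
    obtain ⟨hflat, hlen, -⟩ := batchesT_spec hc rumors
    have hcount : (batchesT c rumors).val.length ≤ (k + c - 1) / c := by
      refine length_batchesT_le hc ?_
      rw [List.length_map]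
      exact (List.length_filter_le _ _).trans hk
    set bs := (batchesT c rumors).val
    have hmem : ∀ s, (∃ b ∈ bs, s ∈ b) ↔ (v, s) ∈ h := by
      intro s
      rw [← List.mem_flatten, hflat]
      simp [rumors]
    obtain ⟨hf, hsent⟩ := feasible_map_send (G := G) (c := c) (v := v) (bs := bs) (K := K) hlen
      (fun b hb s hs => (hh _ ((hmem s).1 ⟨b, hb, hs⟩)).2)
    set h' := h.map fun x => if x.1 = v then (p, x.2) else x
    obtain ⟨ih1, ih2, ih3⟩ := ih (K := knowledgeAfter G K (bs.map fun b => (v, b))) (h := h')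
      (by simpa [h'] using hk) (by
        intro x hx
        obtain ⟨y, hy, rfl⟩ := List.mem_map.1 hx
        obtain ⟨hy1, hy2⟩ := hh y hy
        split_ifs with hyv
        · obtain ⟨b, hb, hs⟩ := (hmem y.2).2 (by rw [← hyv]; exact hy)
          exact ⟨hp, hsent p hadj.symm b hb _ hs⟩
        · refine ⟨(List.mem_cons.1 hy1).resolve_left hyv, subset_knowledgeAfter _ _ _ hy2⟩)
    refine ⟨feasible_append.2 ⟨hf, ih1⟩, fun x hx => ?_, ?_⟩
    · rw [knowledgeAfter_append]
      have := ih2 _ (List.mem_map_of_mem hx)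
      split_ifs at this <;> exact this
    · obtain ⟨m, hm⟩ : ∃ m, T.length = m + 1 :=
        ⟨T.length - 1, by cases hT <;> simp⟩
      simp only [List.length_append, List.length_map, List.length_cons, hm] at ih3 ⊢
      simp only [Nat.add_sub_cancel] at ih3 ⊢
      rw [add_mul]
      omega

/-- Dissemination: if the root knows the given batches, all nodes in and next to the tree learn
them. -/
theorem disseminateT_spec (hT : RootedTree G r T) {c : ℕ} {K : Knowledge n}
    {bs : List (List (Fin n))} (hc : ∀ b ∈ bs, b.length ≤ c) (hK : ∀ b ∈ bs, ∀ s ∈ b, s ∈ K r) :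
    Feasible G c K (disseminateT bs T).val ∧
      (∀ v, v ∈ T.map Prod.fst ∨ (∃ u ∈ T.map Prod.fst, G.Adj u v) → ∀ b ∈ bs, ∀ s ∈ b,
        s ∈ knowledgeAfter G K (disseminateT bs T).val v) ∧
      (disseminateT bs T).val.length = T.length * bs.length := by
  induction hT with
  | root =>
    obtain ⟨h1, h2⟩ := feasible_map_send (G := G) (c := c) (v := r) (bs := bs) (K := K) hc hK
    simp only [disseminateT, val_bind, val_tick, mapT_val, appendT_val, List.nil_append,
      List.map_cons, List.map_nil, List.mem_singleton, exists_eq_left]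
    refine ⟨h1, ?_, by simp⟩
    rintro v (rfl | hv) b hb s hs
    · exact subset_knowledgeAfter _ _ _ (hK b hb s hs)
    · exact h2 v hv b hb s hs
  | @grow T v p hT hv hp hadj ih =>
    obtain ⟨ih1, ih2, ih3⟩ := ih
    simp only [disseminateT, val_bind, val_tick, mapT_val, appendT_val]
    obtain ⟨h1, h2⟩ := feasible_map_send (G := G) (c := c) (v := v) (bs := bs)
      (K := knowledgeAfter G K (disseminateT bs T).val) hc
      (fun b hb s hs => ih2 v (Or.inr ⟨p, hp, hadj⟩) b hb s hs)
    refine ⟨feasible_append.2 ⟨ih1, h1⟩, fun w hw b hb s hs => ?_, ?_⟩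
    · rw [knowledgeAfter_append]
      rw [List.map_cons] at hw
      by_cases hw' : w ∈ T.map Prod.fst ∨ ∃ u ∈ T.map Prod.fst, G.Adj u w
      · exact subset_knowledgeAfter _ _ _ (ih2 w hw' b hb s hs)
      · push Not at hw'
        rcases hw with hw | ⟨u, hu, huw⟩
        · rw [(List.mem_cons.1 hw).resolve_right hw'.1]
          exact subset_knowledgeAfter _ _ _ (ih2 v (Or.inr ⟨p, hp, hadj⟩) b hb s hs)
        · rcases List.mem_cons.1 hu with rfl | hu
          · exact h2 w huw b hb s hs
          · exact absurd huw (hw'.2 u hu)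
    · simp [ih3, add_mul]

end RootedTree

end

section

variable {G : SimpleGraph (Fin n)} [DecidableRel G.Adj]

/-- Every round adds a node, so the fuel lasts until the tree has no neighbour left in `B`. -/
theorem treeT_spec {r : Fin n} {B : List (Fin n)} (fuel : ℕ) {T : List (Fin n × Fin n)}
    (hT : RootedTree G r T) (hTB : ∀ v ∈ T.map Prod.fst, v ∈ B) (hfuel : n < fuel + T.length) :
    RootedTree G r (treeT G B fuel T).val ∧ (∀ v ∈ (treeT G B fuel T).val.map Prod.fst, v ∈ B) ∧
      ∀ v ∈ B, v ∉ (treeT G B fuel T).val.map Prod.fst →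
        ∀ p ∈ (treeT G B fuel T).val.map Prod.fst, ¬ G.Adj p v := by
  induction fuel generalizing T with
  | zero =>
    have := hT.length_le
    omega
  | succ fuel ih =>
    simp only [treeT, val_bind]
    generalize ho : (findT _ B).val = o
    rcases o with _ | v
    · refine ⟨hT, hTB, fun v hv (hvT : v ∉ T.map Prod.fst) p (hp : p ∈ T.map Prod.fst) hpv => ?_⟩
      rw [findT_val, List.find?_eq_none] at ho
      have := ho v hv
      obtain ⟨e, he, rfl⟩ := List.mem_map.1 hp
      simp at this hvT
      exact this (fun a b hab h => hvT b (h ▸ hab)) e.1 e.2 he hpv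
    · rw [findT_val] at ho
      have hvB := List.mem_of_find?_eq_some ho
      have hv := List.find?_some ho
      simp only [val_bind, anyT_val, val_tick, Bool.and_eq_true, Bool.not_eq_true',
        List.any_eq_false, decide_eq_true_eq, List.any_eq_true] at hv
      simp only [val_bind]
      generalize hq : (findT _ T).val = q
      rcases q with _ | e
      · rw [findT_val, List.find?_eq_none] at hq
        obtain ⟨e, he, hev⟩ := hv.2
        exact absurd hev (by simpa using hq e he)
      · rw [findT_val] at hq
        have he := List.mem_of_find?_eq_some hq
        have hev := List.find?_some hq
        simp only [val_tick, decide_eq_true_eq] at hev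
        refine ih (RootedTree.grow hT ?_ (List.mem_map_of_mem he) hev) ?_ ?_
        · intro h
          obtain ⟨x, hx, rfl⟩ := List.mem_map.1 h
          exact hv.1 x hx rfl
        · intro w hw
          rcases List.mem_cons.1 hw with rfl | hw
          · exact hvB
          · exact hTB w hw
        · rw [List.length_cons]; omega

theorem treeT_spans {r : Fin n} {B : List (Fin n)} (hr : r ∈ B)
    (hB : ∀ v ∈ B, (blackGraph G {x | x ∈ B}).Reachable r v) :
    RootedTree G r (treeT G B n [(r, r)]).val ∧
      ∀ v, v ∈ (treeT G B n [(r, r)]).val.map Prod.fst ↔ v ∈ B := by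
  obtain ⟨h1, h2, h3⟩ := treeT_spec (G := G) (B := B) n RootedTree.root (by simpa using hr)
    (by simp)
  refine ⟨h1, fun v => ⟨h2 v, fun hv => ?_⟩⟩
  by_contra hvT
  obtain ⟨w⟩ := hB v hv
  obtain ⟨d, -, hd₁, hd₂⟩ := w.exists_boundary_dart
    {v | v ∈ (treeT G B n [(r, r)]).val.map Prod.fst} h1.root_mem hvT
  exact h3 d.snd d.adj.2.2 hd₂ d.fst hd₁ d.adj.1

/-- After the messages of the sources outside `B`, every rumor is known to its holder in `B`. -/
theorem enterT_spec {B : List (Fin n)} (hB : ∀ v, v ∈ B ∨ ∃ u ∈ B, G.Adj v u) {c : ℕ} (hc : 1 ≤ c)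
    (l : List (Fin n)) {K : Knowledge n} (hK : ∀ s ∈ l, s ∈ K s) :
    Feasible G c K (enterT G B l).val.1 ∧
      (∀ x ∈ (enterT G B l).val.2,
        x.1 ∈ B ∧ x.2 ∈ knowledgeAfter G K (enterT G B l).val.1 x.1) ∧
      (enterT G B l).val.2.map Prod.snd = l ∧ (enterT G B l).val.1.length ≤ l.length := by
  induction l generalizing K with
  | nil => simp [enterT, Feasible]
  | cons s l ih =>
    simp only [enterT, val_bind, memT_val]
    by_cases hs : s ∈ B
    · obtain ⟨h1, h2, h3, h4⟩ := ih fun x hx => hK x (List.mem_cons_of_mem _ hx)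
      simp only [hs, decide_true, if_true, val_tick]
      refine ⟨h1, ?_, by simp [h3], by simp; omega⟩
      intro x hx
      rcases List.mem_cons.1 hx with rfl | hx
      · exact ⟨hs, subset_knowledgeAfter _ _ _ (hK s (by simp))⟩
      · exact h2 x hx
    · simp only [hs, decide_false, Bool.false_eq_true, if_false, val_bind]
      rcases hq : (findT (fun p => tick (decide (G.Adj s p))) B).val with _ | p
      · rw [findT_val, List.find?_eq_none] at hq
        obtain ⟨u, hu, hsu⟩ := (hB s).resolve_left hs
        exact absurd hsu (by simpa using hq u hu)
      · rw [findT_val] at hq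
        have hp := List.mem_of_find?_eq_some hq
        have hsp := List.find?_some hq
        simp only [val_tick, decide_eq_true_eq] at hsp
        obtain ⟨h1, h2, h3, h4⟩ := ih (K := deliver G K (s, [s]))
          fun x hx => Or.inl (hK x (List.mem_cons_of_mem _ hx))
        simp only [val_tick]
        refine ⟨⟨⟨by simpa using hc, by simpa using hK s (by simp)⟩, h1⟩, ?_, by simp [h3],
          by simpa using h4⟩
        intro x hx
        rw [knowledgeAfter_cons]
        rcases List.mem_cons.1 hx with rfl | hx
        · exact ⟨hp, subset_knowledgeAfter _ _ _ (Or.inr ⟨hsp, by simp⟩)⟩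
        · exact h2 x hx

theorem messageEfficient_val {cds : Timed (List (Fin n))} {S : List (Fin n)} {c : ℕ} {r : Fin n}
    {l : List (Fin n)} (h : List.finRange n = r :: l) :
    let B := (insertT r cds.val).val
    let T := (treeT G B n [(r, r)]).val
    let e := (enterT G B S).val
    (messageEfficient G cds S c).val =
      e.1 ++ ((collectT c T e.2).val ++ (disseminateT (batchesT c S).val T).val) := by
  unfold messageEfficient
  rw [h]
  simp only [val_bind, appendT_val]

/-- With a connected dominating set `D`, the algorithm outputs a multi-broadcast schedule with at most
`k + (2 |D| + 1) ⌈k / c⌉` messages: the backbone has at most `|D| + 1` nodes, all of which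
disseminate, and all of which but the root take part in the convergecast. -/
theorem messageEfficient_spec {cds : Timed (List (Fin n))} {S : Finset (Fin n)} {c : ℕ}
    (hn : 0 < n) (hcds : IsCDS G cds.val.toFinset) (hc : 1 ≤ c) :
    IsMultiBroadcast G S c (messageEfficient G cds (S.sort (· ≤ ·)) c).val ∧
      (messageEfficient G cds (S.sort (· ≤ ·)) c).val.length ≤
        S.card + (2 * cds.val.length + 1) * ((S.card + c - 1) / c) := by
  obtain ⟨r, l, hrl⟩ := exists_finRange_eq_cons hn
  rw [messageEfficient_val hrl]
  set B := (insertT r cds.val).val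
  obtain ⟨hdom, -, hconn⟩ := isCDS_iff.1 hcds
  simp only [List.mem_toFinset, coe_toFinset_eq_setOf] at hdom hconn
  have hrB : r ∈ B := mem_insertT.2 (Or.inl rfl)
  have hDB : ∀ v ∈ cds.val, v ∈ B := fun v hv => mem_insertT.2 (Or.inr hv)
  have hconnB : ∀ v ∈ B, (blackGraph G {x | x ∈ B}).Reachable r v := by
    have hmono : blackGraph G {x | x ∈ cds.val} ≤ blackGraph G {x | x ∈ B} := blackGraph_mono hDB
    intro v hv
    rcases mem_insertT.1 hv with rfl | hv
    · exact SimpleGraph.Reachable.refl _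
    · rcases hdom r with hr | ⟨u, hu, hur⟩
      · exact (hconn r hr v hv).mono hmono
      · have hru : (blackGraph G {x | x ∈ B}).Adj r u := ⟨hur.symm, hrB, hDB u hu⟩
        exact hru.reachable.trans ((hconn u hu v hv).mono hmono)
  have hdomB : ∀ v, v ∈ B ∨ ∃ u ∈ B, G.Adj v u := by
    intro v
    rcases hdom v with h | ⟨u, hu, huv⟩
    · exact Or.inl (hDB v h)
    · exact Or.inr ⟨u, hDB u hu, huv.symm⟩
  obtain ⟨hT, hTB⟩ := treeT_spans hrB hconnB
  set T := (treeT G B n [(r, r)]).val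
  have hlenS : (S.sort (· ≤ ·)).length = S.card := by simp
  obtain ⟨he1, he2, he3, he4⟩ := enterT_spec hdomB hc (S.sort (· ≤ ·))
    (K := initialKnowledge S) (fun s hs => ⟨rfl, by simpa using hs⟩)
  set e := (enterT G B (S.sort (· ≤ ·))).val
  have helen : e.2.length = S.card := by
    rw [← hlenS, ← he3, List.length_map]
  obtain ⟨hu1, hu2, hu3⟩ := hT.collectT_spec hc (K := knowledgeAfter G (initialKnowledge S) e.1)
    helen.le fun x hx => ⟨(hTB _).2 (he2 x hx).1, (he2 x hx).2⟩
  obtain ⟨hflat, hbc, -⟩ := batchesT_spec hc (S.sort (· ≤ ·))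
  have hbs := length_batchesT_le hc hlenS.le
  set bs := (batchesT c (S.sort (· ≤ ·))).val
  have hbmem : ∀ s, (∃ b ∈ bs, s ∈ b) ↔ s ∈ S := by
    intro s
    rw [← List.mem_flatten, hflat]
    simp
  obtain ⟨hd1, hd2, hd3⟩ := hT.disseminateT_spec (c := c) (bs := bs)
    (K := knowledgeAfter G (knowledgeAfter G (initialKnowledge S) e.1) (collectT c T e.2).val)
    hbc (fun b hb s hs => by
      have hs : s ∈ e.2.map Prod.snd := by
        rw [he3]
        simpa using (hbmem s).1 ⟨b, hb, hs⟩
      obtain ⟨x, hx, rfl⟩ := List.mem_map.1 hs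
      exact hu2 x hx)
  refine ⟨⟨feasible_append.2 ⟨he1, feasible_append.2 ⟨hu1, hd1⟩⟩, fun v s hs => ?_⟩, ?_⟩
  · obtain ⟨b, hb, hsb⟩ := (hbmem s).2 hs
    rw [knowledgeAfter_append, knowledgeAfter_append]
    refine hd2 v ?_ b hb s hsb
    simp only [hTB]
    rcases hdomB v with h | ⟨u, hu, hvu⟩
    · exact Or.inl h
    · exact Or.inr ⟨u, hu, hvu.symm⟩
  · have hTlen : T.length ≤ cds.val.length + 1 := by
      have h1 : (T.map Prod.fst).toFinset ⊆ B.toFinset := fun v hv => by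
        simpa [-List.mem_map] using (hTB v).1 (by simpa using hv)
      have h2 := Finset.card_le_card h1
      rw [List.toFinset_card_of_nodup hT.nodup, List.length_map] at h2
      exact (h2.trans (List.toFinset_card_le _)).trans (length_insertT r cds.val)
    set q := (S.card + c - 1) / c
    have h1 : (T.length - 1) * q ≤ cds.val.length * q := Nat.mul_le_mul_right _ (by omega)
    have h2 : T.length * bs.length ≤ (cds.val.length + 1) * q := Nat.mul_le_mul hTlen hbs
    simp only [List.length_append, hd3]
    rw [hlenS] at he4
    linarith

end

/-! ### Number of elementary steps

All costs are bounded by powers of `n + 2`, with generous exponents. -/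

/-- A loop with fewer than `(n + 2) ^ i` rounds of cost at most `(n + 2) ^ j`. -/
theorem loop_cost_le {a C i j : ℕ} (ha : a < (n + 2) ^ i) (hC : C ≤ (n + 2) ^ j) (hij : i ≤ j) :
    a * (C + 1) + 1 ≤ (n + 2) ^ (i + j) := by
  obtain ⟨b, hb⟩ : ∃ b, (n + 2) ^ i = b + 1 := ⟨(n + 2) ^ i - 1, by omega⟩
  have h1 : (n + 2) ^ i ≤ (n + 2) ^ j := Nat.pow_le_pow_right (by omega) hij
  have h2 : a * (C + 1) ≤ b * ((n + 2) ^ j + 1) := Nat.mul_le_mul (by omega) (by omega)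
  rw [pow_add, hb]
  rw [hb] at h1
  linarith

theorem pow_le_pow_add {a i j : ℕ} (h : a ≤ (n + 2) ^ i) (hij : i ≤ j) : a ≤ (n + 2) ^ j :=
  h.trans (Nat.pow_le_pow_right (by omega) hij)

/-- A sum of at most eight terms, each bounded by `(n + 2) ^ i`. -/
theorem eight_terms_le {a i : ℕ} (h : a ≤ 8 * (n + 2) ^ i) : a ≤ (n + 2) ^ (i + 3) := by
  have h8 : 2 ^ 3 ≤ (n + 2) ^ 3 := Nat.pow_le_pow_left (by omega) 3
  rw [pow_add, mul_comm]
  exact h.trans (Nat.mul_le_mul_right _ h8)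

theorem lt_pow_one {a : ℕ} (h : a ≤ n + 1) : a < (n + 2) ^ 1 := by
  rw [pow_one]; omega

theorem tick_loop_cost_le {a : ℕ} (ha : a ≤ n + 1) : a * (1 + 1) + 1 ≤ (n + 2) ^ 2 := by
  nlinarith

theorem anyT_tick_cost_le {α : Type} {l : List α} (hl : l.length ≤ n + 1) (p : α → Bool) :
    (anyT (fun a => tick (p a)) l).cost ≤ (n + 2) ^ 2 :=
  (anyT_cost (C := 1) fun _ _ => le_rfl).trans (tick_loop_cost_le hl)

theorem findT_tick_cost_le {α : Type} {l : List α} (hl : l.length ≤ n + 1) (p : α → Bool) :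
    (findT (fun a => tick (p a)) l).cost ≤ (n + 2) ^ 2 :=
  (findT_cost (C := 1) fun _ _ => le_rfl).trans (tick_loop_cost_le hl)

theorem filterT_tick_cost_le {α : Type} {l : List α} (hl : l.length ≤ n + 1) (p : α → Bool) :
    (filterT (fun a => tick (p a)) l).cost ≤ (n + 2) ^ 2 :=
  (filterT_cost (C := 1) fun _ _ => le_rfl).trans (tick_loop_cost_le hl)

theorem mapT_tick_cost_le {α β : Type} {l : List α} (hl : l.length ≤ n + 1) (f : α → β) :
    (mapT (fun a => tick (f a)) l).cost ≤ (n + 2) ^ 2 :=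
  (mapT_cost (C := 1) fun _ _ => le_rfl).trans (tick_loop_cost_le hl)

theorem memT_cost_le (x : Fin n) {B : List (Fin n)} (hB : B.length ≤ n + 1) :
    (memT x B).cost ≤ (n + 2) ^ 2 :=
  anyT_tick_cost_le hB _

section

variable {G : SimpleGraph (Fin n)} [DecidableRel G.Adj]

theorem hasNeighborT_cost_le {B : List (Fin n)} (hB : B.length ≤ n + 1) (x : Fin n) :
    (hasNeighborT G B x).cost ≤ (n + 2) ^ 2 :=
  anyT_tick_cost_le hB _

theorem componentT_cost_le {B : List (Fin n)} (hB : B.length ≤ n + 1) (x : Fin n) :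
    (componentT G B x).cost ≤ (n + 2) ^ 4 := by
  refine (iterT_cost (C := (n + 2) ^ 3 + 1) (fun R => R.length ≤ n + 1) (fun R hR => ⟨?_, ?_⟩) n
    (by simp)).trans (loop_cost_le (lt_pow_one (by omega)) le_rfl (by omega))
  · refine ((filterT_cost fun y _ => anyT_tick_cost_le hR _).trans
      (loop_cost_le (i := 1) (j := 2) (lt_pow_one hB) le_rfl (by omega))).trans (Nat.le_succ _)
  · rw [filterT_val]
    exact (List.length_filter_le _ _).trans hB

theorem length_componentT_le {B : List (Fin n)} (hB : B.length ≤ n + 1) (x : Fin n) :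
    (componentT G B x).val.length ≤ n + 1 := by
  rw [componentT, iterT_val]
  rcases Nat.eq_zero_or_pos n with h | h
  · simp [h]
  · obtain ⟨m, hm⟩ : ∃ m, n = m + 1 := ⟨n - 1, by omega⟩
    rw [show ∀ f : List (Fin n) → List (Fin n), f^[n] = f^[m + 1] from fun f => by rw [← hm],
      Function.iterate_succ_apply', filterT_val]
    exact (List.length_filter_le _ _).trans hB

theorem piecesT_cost_le {B : List (Fin n)} (hB : B.length ≤ n + 1) :
    (piecesT G B).cost ≤ (n + 2) ^ 8 := by
  refine (countT_cost (C := (n + 2) ^ 7) fun x _ => ?_).trans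
    (loop_cost_le (lt_pow_one (by simp)) le_rfl (by omega))
  have h1 := pow_le_pow_add (memT_cost_le x hB) (show 2 ≤ 4 by omega)
  have h2 := componentT_cost_le (G := G) hB x
  have h3 := pow_le_pow_add (hasNeighborT_cost_le (G := G) hB x) (show 2 ≤ 4 by omega)
  have h4 := pow_le_pow_add (anyT_tick_cost_le (length_componentT_le (G := G) hB x)
    fun y => decide (y < x)) (show 2 ≤ 4 by omega)
  have h5 := Nat.one_le_pow 4 (n + 2) (by omega)
  refine eight_terms_le (i := 4) ?_
  rw [cost_bind]
  split_ifs
  · simp only [cost_bind, cost_tick]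
    omega
  · simp only [cost_bind, cost_tick]
    omega

theorem unionT_cost_le {B X : List (Fin n)} (hB : B.Nodup) (hX : X.length ≤ 2) :
    (unionT X B).cost ≤ (n + 2) ^ 3 := by
  have h1 := unionT_cost hB X
  have h2 : X.length * (2 * n + 2) ≤ 2 * (2 * n + 2) := Nat.mul_le_mul_right _ hX
  have h3 : 2 ^ 2 ≤ (n + 2) ^ 2 := Nat.pow_le_pow_left (by omega) 2
  have h4 : 2 ^ 2 * (n + 2) ≤ (n + 2) ^ 2 * (n + 2) := Nat.mul_le_mul_right _ h3
  rw [pow_succ]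
  omega

theorem greedyT_cost_le {cands : List (List (Fin n))} (hlen : cands.length < (n + 2) ^ 2)
    (hX : ∀ X ∈ cands, X.length ≤ 2) (fuel : ℕ) {B : List (Fin n)} (hB : B.Nodup) :
    (greedyT G cands fuel B).cost ≤ fuel * ((n + 2) ^ 16 + 1) + 1 := by
  induction fuel generalizing B with
  | zero => simp [greedyT]
  | succ fuel ih =>
    have hlenB : ∀ {B : List (Fin n)}, B.Nodup → B.length ≤ n + 1 := fun hB =>
      (length_le_of_nodup hB).trans (Nat.le_succ n)
    have h1 := pow_le_pow_add (piecesT_cost_le (G := G) (hlenB hB)) (show 8 ≤ 13 by omega)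
    have h2 : (argminT (fun X => unionT X B >>= fun B' => piecesT G B') cands).cost ≤
        (n + 2) ^ 13 := by
      refine (argminT_cost (C := (n + 2) ^ 11) fun X hXc => ?_).trans
        (loop_cost_le hlen le_rfl (by omega))
      have h3 := pow_le_pow_add (unionT_cost_le hB (hX X hXc)) (show 3 ≤ 8 by omega)
      have h4 := piecesT_cost_le (G := G) (hlenB (nodup_unionT (X := X) hB))
      refine eight_terms_le (i := 8) ?_
      rw [cost_bind]
      omega
    have h5 := Nat.one_le_pow 13 (n + 2) (by omega)
    simp only [greedyT, cost_bind]
    rcases ho : (argminT (fun X => unionT X B >>= fun B' => piecesT G B') cands).val with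
      _ | ⟨X, q⟩
    · have h6 : (piecesT G B).cost +
          ((argminT (fun X => unionT X B >>= fun B' => piecesT G B') cands).cost + 1) ≤
          (n + 2) ^ 16 := eight_terms_le (i := 13) (by omega)
      simp only [cost_tick]
      rw [add_mul]
      omega
    · have hXc := (argminT_val_eq_some ho).1
      have h3 := pow_le_pow_add (unionT_cost_le hB (hX X hXc)) (show 3 ≤ 13 by omega)
      have h6 : (piecesT G B).cost +
          ((argminT (fun X => unionT X B >>= fun B' => piecesT G B') cands).cost +
            ((unionT X B).cost + 1)) ≤ (n + 2) ^ 16 := eight_terms_le (i := 13) (by omega)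
      have h7 := ih (nodup_unionT (X := X) hB)
      simp only []
      split_ifs
      · simp only [cost_bind]
        rw [add_mul]
        omega
      · simp only [cost_tick]
        rw [add_mul]
        omega

theorem singlesT_cost_le : (singlesT n).cost ≤ (n + 2) ^ 2 :=
  mapT_tick_cost_le (by simp) _

theorem length_singlesT : (singlesT n).val.length = n := by
  simp [singlesT]

theorem pairsT_cost_le : (pairsT n).cost ≤ (n + 2) ^ 6 := by
  refine (flatMapT_cost (C := (n + 2) ^ 5) fun u _ => eight_terms_le (i := 2) ?_).trans
    (loop_cost_le (lt_pow_one (by simp)) le_rfl (by omega))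
  have h1 := mapT_tick_cost_le (n := n) (l := List.finRange n) (by simp) fun v => [u, v]
  have h2 : n + 2 ≤ (n + 2) ^ 2 := Nat.le_self_pow (by omega) _
  rw [mapT_val, List.length_map, List.length_finRange]
  omega

theorem length_pairsT : (pairsT n).val.length = n * n := by
  simp [pairsT, List.length_flatMap]

theorem greedyT_singlesT_cost_le {B : List (Fin n)} (hB : B.Nodup) :
    (greedyT G (singlesT n).val n B).cost ≤ (n + 2) ^ 17 := by
  refine (greedyT_cost_le ?_ ?_ n hB).trans
    (loop_cost_le (i := 1) (j := 16) (lt_pow_one (by omega)) le_rfl (by omega))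
  · rw [length_singlesT]; nlinarith
  · intro X hX
    obtain ⟨v, rfl⟩ := mem_singlesT.1 hX
    simp

theorem greedyT_pairsT_cost_le {B : List (Fin n)} (hB : B.Nodup) :
    (greedyT G (pairsT n).val n B).cost ≤ (n + 2) ^ 17 := by
  refine (greedyT_cost_le ?_ ?_ n hB).trans
    (loop_cost_le (i := 1) (j := 16) (lt_pow_one (by omega)) le_rfl (by omega))
  · rw [length_pairsT]; nlinarith
  · intro X hX
    obtain ⟨u, v, rfl⟩ := mem_pairsT.1 hX
    simp

theorem greedyCDS_cost_le : (greedyCDS G).cost ≤ (n + 2) ^ 20 := by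
  have h1 := pow_le_pow_add (singlesT_cost_le (n := n)) (show 2 ≤ 17 by omega)
  have h2 := greedyT_singlesT_cost_le (G := G) List.nodup_nil
  have h3 := pow_le_pow_add (pairsT_cost_le (n := n)) (show 6 ≤ 17 by omega)
  have h4 := greedyT_pairsT_cost_le (G := G)
    (GreedyStep.reflTransGen_nodup (greedyT_spec (singlesT n).val n [] (card_pieces_le G _)).1
      List.nodup_nil)
  refine eight_terms_le (i := 17) ?_
  simp only [greedyCDS, cost_bind]
  omega

theorem extendMIS_cost_le (fuel : ℕ) {I : List (Fin n)} (hI : fuel + I.length ≤ n + 1) :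
    (extendMIS G fuel I).cost ≤ fuel * ((n + 2) ^ 10 + 1) + 1 := by
  induction fuel generalizing I with
  | zero => simp [extendMIS]
  | succ fuel ih =>
    have hlen : I.length ≤ n + 1 := by omega
    simp only [extendMIS, cost_bind]
    generalize ho : findT _ (List.finRange n) = o
    have hfind : o.cost ≤ (n + 2) ^ 10 := by
      rw [← ho]
      refine (findT_cost (C := (n + 2) ^ 9) fun x _ => eight_terms_le (i := 6) ?_).trans
        (loop_cost_le (lt_pow_one (by simp)) le_rfl (by omega))
      have h1 := pow_le_pow_add (memT_cost_le x hlen) (show 2 ≤ 6 by omega)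
      have h2 := pow_le_pow_add (hasNeighborT_cost_le (G := G) hlen x) (show 2 ≤ 6 by omega)
      have h3 : (anyT (fun y => hasNeighborT G I y >>= fun e => tick (decide (G.Adj x y) && e))
          (List.finRange n)).cost ≤ (n + 2) ^ 6 := by
        refine (anyT_cost (C := (n + 2) ^ 5) fun y _ => eight_terms_le (i := 2) ?_).trans
          (loop_cost_le (lt_pow_one (by simp)) le_rfl (by omega))
        have h4 := hasNeighborT_cost_le (G := G) hlen y
        have h5 := Nat.one_le_pow 2 (n + 2) (by omega)
        simp only [cost_bind, cost_tick]
        omega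
      have h5 := Nat.one_le_pow 6 (n + 2) (by omega)
      simp only [cost_bind, cost_tick] at h3 ⊢
      omega
    rcases o.val with _ | x
    · simp only [cost_tick]
      rw [add_mul]
      omega
    · have := ih (I := x :: I) (by rw [List.length_cons]; omega)
      simp only []
      rw [add_mul]
      omega

theorem misCDS_cost_le : (misCDS G).cost ≤ (n + 2) ^ 20 := by
  rcases Nat.eq_zero_or_pos n with rfl | hn
  · simp [misCDS]
  obtain ⟨r, l, hrl⟩ := exists_finRange_eq_cons hn
  have h1 := pow_le_pow_add (singlesT_cost_le (n := n)) (show 2 ≤ 17 by omega)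
  have h2 := pow_le_pow_add ((extendMIS_cost_le (G := G) n (I := [r]) (by simp)).trans
    (loop_cost_le (lt_pow_one (by omega)) le_rfl (by omega))) (show 1 + 10 ≤ 17 by omega)
  have h3 := greedyT_singlesT_cost_le (G := G)
    (extendMIS_spec (G := G) (r := r) n GrownFrom.base (by simp)).1.nodup
  refine eight_terms_le (i := 17) ?_
  unfold misCDS
  rw [hrl]
  simp only [cost_bind]
  omega

theorem length_treeT_le (B : List (Fin n)) (fuel : ℕ) (T : List (Fin n × Fin n)) :
    (treeT G B fuel T).val.length ≤ T.length + fuel := by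
  induction fuel generalizing T with
  | zero => simp [treeT]
  | succ fuel ih =>
    simp only [treeT, val_bind]
    generalize (findT _ B).val = o
    rcases o with _ | v
    · simp only [val_tick]; omega
    · simp only [val_bind]
      generalize (findT _ T).val = q
      rcases q with _ | e
      · simp only [val_tick]; omega
      · have := ih ((v, e.1) :: T)
        rw [List.length_cons] at this
        simp only []
        omega

theorem treeT_cost_le {B : List (Fin n)} (hB : B.length ≤ n + 1) (fuel : ℕ)
    {T : List (Fin n × Fin n)} (hT : fuel + T.length ≤ n + 1) :
    (treeT G B fuel T).cost ≤ fuel * ((n + 2) ^ 9 + 1) + 1 := by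
  induction fuel generalizing T with
  | zero => simp [treeT]
  | succ fuel ih =>
    have hany : ∀ p : Fin n × Fin n → Bool, (anyT (fun e => tick (p e)) T).cost ≤ (n + 2) ^ 2 :=
      anyT_tick_cost_le (by omega)
    have h1 := Nat.one_le_pow 2 (n + 2) (by omega)
    simp only [treeT, cost_bind]
    generalize ho : findT _ B = o
    have hfind : o.cost ≤ (n + 2) ^ 6 := by
      rw [← ho]
      refine (findT_cost (C := (n + 2) ^ 5) fun v _ => eight_terms_le (i := 2) ?_).trans
        (loop_cost_le (lt_pow_one hB) le_rfl (by omega))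
      have h2 := hany fun e => decide (e.1 = v)
      have h3 := hany fun e => decide (G.Adj e.1 v)
      simp only [cost_bind, cost_tick]
      omega
    have h26 := Nat.pow_le_pow_right (show 0 < n + 2 by omega) (show 2 ≤ 6 by omega)
    rcases o.val with _ | v
    · have h6 : o.cost + 1 ≤ (n + 2) ^ 9 := eight_terms_le (i := 6) (by omega)
      simp only [cost_tick]
      rw [add_mul]
      omega
    · simp only [cost_bind]
      generalize hq : findT _ T = q
      have hfind' : q.cost ≤ (n + 2) ^ 2 := by
        rw [← hq]
        exact findT_tick_cost_le (by omega) _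
      have h6 : o.cost + (q.cost + 1) ≤ (n + 2) ^ 9 := eight_terms_le (i := 6) (by omega)
      rcases q.val with _ | e
      · simp only [cost_tick]
        rw [add_mul]
        omega
      · have := ih (T := (v, e.1) :: T) (by rw [List.length_cons]; omega)
        simp only []
        rw [add_mul]
        omega

theorem length_enterT_le (B l : List (Fin n)) :
    (enterT G B l).val.1.length ≤ l.length ∧ (enterT G B l).val.2.length ≤ l.length := by
  induction l with
  | nil => simp [enterT]
  | cons s l ih =>
    simp only [enterT, val_bind]
    split_ifs
    · simp only [val_tick, List.length_cons]; omega
    · simp only [val_bind]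
      generalize (findT _ B).val = q
      rcases q with _ | p <;> simp only [val_tick, List.length_cons] <;> omega

theorem enterT_cost_le {B : List (Fin n)} (hB : B.length ≤ n + 1) (l : List (Fin n)) :
    (enterT G B l).cost ≤ l.length * ((n + 2) ^ 5 + 1) + 1 := by
  induction l with
  | nil => simp [enterT]
  | cons s l ih =>
    have h1 := memT_cost_le s hB
    have h2 : (findT (fun p => tick (decide (G.Adj s p))) B).cost ≤ (n + 2) ^ 2 :=
      findT_tick_cost_le hB _
    have h3 := Nat.one_le_pow 2 (n + 2) (by omega)
    have h4 : (memT s B).cost + ((findT (fun p => tick (decide (G.Adj s p))) B).cost + 1) ≤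
      (n + 2) ^ 5 := eight_terms_le (i := 2) (by omega)
    simp only [enterT, cost_bind, List.length_cons]
    rw [add_mul]
    split_ifs
    · simp only [cost_tick]; omega
    · simp only [cost_bind]
      rcases (findT (fun p => tick (decide (G.Adj s p))) B).val with _ | p <;>
        simp only [cost_tick] <;> omega

end

theorem length_batchesT_le_length {c : ℕ} (hc : 1 ≤ c) (l : List (Fin n)) :
    (batchesT c l).val.length ≤ l.length := by
  rcases (batchesT_spec hc l).2.2 with h | ⟨b, bs, h, hb, hlen⟩
  · simp [h]
  · have : bs.length * 1 ≤ bs.length * c := Nat.mul_le_mul_left _ hc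
    rw [h, List.length_cons]
    omega

theorem batchesT_cost_le {c : ℕ} (hc : 1 ≤ c) {l : List (Fin n)} {N : ℕ} (hl : l.length ≤ N) :
    (batchesT c l).cost ≤ l.length * (N + 1) + 1 := by
  induction l with
  | nil => simp [batchesT]
  | cons s l ih =>
    rw [List.length_cons] at hl
    have h1 := ih (by omega)
    simp only [batchesT, cost_bind, List.length_cons]
    rw [add_mul]
    rcases hb : (batchesT c l).val with _ | ⟨b, bs⟩
    · simp only [cost_tick]; omega
    · have h2 : b.length ≤ l.length := by
        have := congrArg List.length (batchesT_spec hc l).1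
        rw [hb, List.flatten_cons, List.length_append] at this
        omega
      simp only [cost_bind, lengthT_cost, cost_tick]
      omega

theorem length_collectT_le {c : ℕ} (hc : 1 ≤ c) (T : List (Fin n × Fin n))
    {h : List (Fin n × Fin n)} {N : ℕ} (hh : h.length ≤ N) :
    (collectT c T h).val.length ≤ T.length * N := by
  induction T generalizing h with
  | nil => simp [collectT]
  | cons e T ih =>
    obtain ⟨v, p⟩ := e
    simp only [collectT]
    split_ifs
    · simp
    · simp only [val_bind, filterT_val, mapT_val, val_tick, appendT_val, List.length_append,
        List.length_map, List.length_cons]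
      have h1 := length_batchesT_le_length hc
        ((h.filter fun x => decide (x.1 = v)).map fun x => x.2)
      rw [List.length_map] at h1
      have h2 := List.length_filter_le (fun x : Fin n × Fin n => decide (x.1 = v)) h
      have h3 := ih (h := h.map fun x => if x.1 = v then (p, x.2) else x)
        (by rwa [List.length_map])
      rw [add_mul]
      omega

theorem collectT_cost_le {c : ℕ} (hc : 1 ≤ c) (T : List (Fin n × Fin n))
    {h : List (Fin n × Fin n)} (hh : h.length ≤ n) :
    (collectT c T h).cost ≤ T.length * ((n + 2) ^ 5 + 1) + 1 := by
  induction T generalizing h with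
  | nil => simp [collectT]
  | cons e T ih =>
    obtain ⟨v, p⟩ := e
    simp only [collectT]
    split_ifs
    · simp
    · set mine := h.filter fun x => decide (x.1 = v)
      have hmine : mine.length ≤ n := (List.length_filter_le _ _).trans hh
      have h1 : (filterT (fun x => tick (decide (x.1 = v))) h).cost ≤ (n + 2) ^ 2 :=
        filterT_tick_cost_le (by omega) _
      have h2 : (mapT (fun x => tick x.2) mine).cost ≤ (n + 2) ^ 2 :=
        mapT_tick_cost_le (by omega) _
      set rumors := mine.map fun x => x.2
      have hr : rumors.length ≤ n := by rwa [List.length_map]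
      have h3 : (batchesT c rumors).cost ≤ (n + 2) ^ 2 :=
        (batchesT_cost_le hc hr).trans
          (loop_cost_le (i := 1) (j := 1) (lt_pow_one (by omega)) (by rw [pow_one]; omega) le_rfl)
      have hbs := (length_batchesT_le_length hc rumors).trans hr
      have h4 : (mapT (fun b => tick (v, b)) (batchesT c rumors).val).cost ≤ (n + 2) ^ 2 :=
        mapT_tick_cost_le (by omega) _
      have h5 : (mapT (fun x => tick (if x.1 = v then (p, x.2) else x)) h).cost ≤ (n + 2) ^ 2 :=
        mapT_tick_cost_le (by omega) _
      have h6 : (batchesT c rumors).val.length + 1 ≤ (n + 2) ^ 2 :=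
        le_trans (by omega) (tick_loop_cost_le (n := n) (a := n) (by omega))
      have h7 := ih (h := h.map fun x => if x.1 = v then (p, x.2) else x)
        (by rwa [List.length_map])
      have h8 : 8 * (n + 2) ^ 2 ≤ (n + 2) ^ 5 := eight_terms_le (i := 2) le_rfl
      simp only [rumors, mine] at h2 h3 h4 h6
      simp only [cost_bind, filterT_val, mapT_val, val_tick, appendT_cost,
        List.length_map, List.length_cons]
      rw [add_mul]
      omega

theorem length_disseminateT (bs : List (List (Fin n))) (T : List (Fin n × Fin n)) :
    (disseminateT bs T).val.length = T.length * bs.length := by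
  induction T with
  | nil => simp [disseminateT]
  | cons e T ih => simp [disseminateT, ih, add_mul]

theorem disseminateT_cost_le {bs : List (List (Fin n))} (hbs : bs.length ≤ n)
    {T : List (Fin n × Fin n)} (hT : T.length ≤ n + 1) :
    (disseminateT bs T).cost ≤ T.length * ((n + 2) ^ 5 + 1) + 1 := by
  induction T with
  | nil => simp [disseminateT]
  | cons e T ih =>
    rw [List.length_cons] at hT
    have h1 := ih (by omega)
    have h2 : (mapT (fun b => tick (e.1, b)) bs).cost ≤ (n + 2) ^ 2 :=
      mapT_tick_cost_le (by omega) _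
    have h3 : T.length * bs.length ≤ (n + 2) * (n + 2) := Nat.mul_le_mul (by omega) (by omega)
    have h4 := Nat.one_le_pow 2 (n + 2) (by omega)
    have h5 : 8 * (n + 2) ^ 2 ≤ (n + 2) ^ 5 := eight_terms_le (i := 2) le_rfl
    simp only [disseminateT, cost_bind, appendT_cost, length_disseminateT, List.length_cons]
    rw [add_mul]
    rw [← sq] at h3
    omega

theorem messageEfficient_cost_le {G : SimpleGraph (Fin n)} [DecidableRel G.Adj]
    {cds : Timed (List (Fin n))} (hcost : cds.cost ≤ (n + 2) ^ 20) (hcds : cds.val.Nodup)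
    (S : Finset (Fin n)) {c : ℕ} (hc : 1 ≤ c) :
    (messageEfficient G cds (S.sort (· ≤ ·)) c).cost ≤ (n + 2) ^ 26 := by
  set L := S.sort (· ≤ ·)
  have hL : L.length ≤ n := by
    simpa [L] using Finset.card_le_univ S
  refine eight_terms_le (i := 23) ?_
  rcases hfin : List.finRange n with _ | ⟨r, l⟩
  · have h1 := pow_le_pow_add hcost (show 20 ≤ 23 by omega)
    have h2 := Nat.one_le_pow 23 (n + 2) (by omega)
    unfold messageEfficient
    rw [hfin]
    simp only [cost_bind, cost_tick]
    omega
  have hDlen := length_le_of_nodup hcds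
  have hins := insertT_cost r cds.val
  have hBlen := (length_insertT r cds.val).trans (Nat.succ_le_succ hDlen)
  set B := (insertT r cds.val).val with hBdef
  have htree := (treeT_cost_le (G := G) hBlen n (T := [(r, r)]) (by simp)).trans
    (loop_cost_le (i := 1) (j := 9) (lt_pow_one (by omega)) le_rfl (by omega))
  have hTlen := length_treeT_le (G := G) B n [(r, r)]
  rw [List.length_singleton] at hTlen
  set T := (treeT G B n [(r, r)]).val with hTdef
  have henter := (enterT_cost_le (G := G) hBlen L).trans
    (loop_cost_le (i := 1) (j := 5) (lt_pow_one (by omega)) le_rfl (by omega))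
  obtain ⟨he1, he2⟩ := length_enterT_le (G := G) B L
  set e := (enterT G B L).val with hedef
  have hup := (collectT_cost_le hc T (he2.trans hL)).trans
    (loop_cost_le (i := 1) (j := 5) (lt_pow_one (by omega)) le_rfl (by omega))
  have huplen := length_collectT_le hc T (he2.trans hL)
  have hbatch := batchesT_cost_le hc hL
  have hbs := (length_batchesT_le_length hc L).trans hL
  have hdown := (disseminateT_cost_le hbs (T := T) (by omega)).trans
    (loop_cost_le (i := 1) (j := 5) (lt_pow_one (by omega)) le_rfl (by omega))
  norm_num only at htree henter hup hdown
  have hsq : T.length * n ≤ (n + 2) * (n + 2) := Nat.mul_le_mul (by omega) (by omega)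
  have hsq' : L.length * (n + 1) ≤ (n + 2) * (n + 2) := Nat.mul_le_mul (by omega) (by omega)
  rw [← sq] at hsq hsq'
  have h1 := pow_le_pow_add (n := n) (le_refl ((n + 2) ^ 2)) (show 2 ≤ 6 by omega)
  have h2 := pow_le_pow_add (n := n) (le_refl ((n + 2) ^ 6)) (show 6 ≤ 20 by omega)
  have h3 := pow_le_pow_add (n := n) (le_refl ((n + 2) ^ 10)) (show 10 ≤ 20 by omega)
  have h4 : n + 2 ≤ (n + 2) ^ 2 := Nat.le_self_pow (by omega) _
  have h5 : 8 * (n + 2) ^ 20 ≤ (n + 2) ^ 23 := eight_terms_le (i := 20) le_rfl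
  unfold messageEfficient
  rw [hfin]
  simp only [cost_bind, appendT_cost, ← hBdef, ← hTdef, ← hedef]
  omega

/-! ### Approximation ratios -/

/-- `(k + c - 1) / c` is the number of batches, `⌈k / c⌉`. -/
theorem add_sub_one_div_le_ceil {k c : ℕ} (hc : 1 ≤ c) :
    (k + c - 1) / c ≤ ⌈(k : ℝ) / c⌉₊ := by
  have hc' : (0 : ℝ) < c := by exact_mod_cast hc
  have h1 : (k : ℝ) ≤ ⌈(k : ℝ) / c⌉₊ * c := (div_le_iff₀ hc').1 (Nat.le_ceil _)
  have h2 : k ≤ ⌈(k : ℝ) / c⌉₊ * c := by exact_mod_cast h1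
  rw [← Nat.lt_succ_iff, Nat.div_lt_iff_lt_mul (by omega), Nat.succ_mul]
  omega

theorem rounding_factor_eq_one {k c : ℕ} (hk : 0 < k) (h : c ∣ k) :
    (⌈(k : ℝ) / c⌉₊ / ((k : ℝ) / c) : ℝ) = 1 := by
  obtain ⟨t, rfl⟩ := h
  have hc : (c : ℝ) ≠ 0 := by
    rintro h
    simp [Nat.cast_eq_zero.1 h] at hk
  have ht : (t : ℝ) ≠ 0 := by
    rintro h
    simp [Nat.cast_eq_zero.1 h] at hk
  rw [Nat.cast_mul, mul_div_cancel_left₀ _ hc, Nat.ceil_natCast, div_self ht]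

/-- The comparison of `k + (2 α d + 1) ⌈k / c⌉` messages with the lower bounds `k` and `k d / c` for the
optimum `m`. -/
theorem message_bound {k c d m α : ℝ} (hk : 0 < k) (hc : 0 < c) (hα : 0 ≤ α) (hkm : k ≤ m)
    (hdm : k * d ≤ c * m) :
    k + (2 * (α * d) + 1) * ⌈k / c⌉₊ ≤
      (⌈k / c⌉₊ / (k / c)) * ((2 * α + 1) * (1 + 1 / c) * m) := by
  have hx : 0 < k / c := div_pos hk hc
  have hF : 1 ≤ ⌈k / c⌉₊ / (k / c) := (one_le_div hx).2 (Nat.le_ceil _)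
  have hFx : (⌈k / c⌉₊ : ℝ) = ⌈k / c⌉₊ / (k / c) * (k / c) := (div_mul_cancel₀ _ hx.ne').symm
  generalize (⌈k / c⌉₊ : ℝ) / (k / c) = F at hF hFx ⊢
  rw [hFx]
  have h1 : d * (k / c) ≤ m := by
    rw [mul_div_assoc', div_le_iff₀ hc]
    linarith
  have h2 : k / c ≤ m * (1 / c) := by
    rw [mul_one_div]
    exact div_le_div_of_nonneg_right hkm hc.le
  have h3 : 2 * α * (d * (k / c)) ≤ 2 * α * m := mul_le_mul_of_nonneg_left h1 (by positivity)
  have h4 : 0 ≤ 2 * α * (m * (1 / c)) := by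
    have := hk.trans_le hkm
    positivity
  have h5 : k + (2 * (α * d) + 1) * (k / c) ≤ (2 * α + 1) * (1 + 1 / c) * m := by linarith
  have h6 : k ≤ F * k := le_mul_of_one_le_left hk.le hF
  have h7 := mul_le_mul_of_nonneg_left h5 (zero_le_one.trans hF)
  linarith

theorem length_messageEfficient_le {G : SimpleGraph (Fin n)} [DecidableRel G.Adj]
    {cds : Timed (List (Fin n))} {S : Finset (Fin n)} {c : ℕ} {α : ℝ} (hn : 2 ≤ n)
    (hc : 1 ≤ c) (hcS : c ≤ S.card) (hcds : IsCDS G cds.val.toFinset) (hα : 0 ≤ α)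
    (hlen : (cds.val.length : ℝ) ≤ α * minCDS G) :
    ((messageEfficient G cds (S.sort (· ≤ ·)) c).val.length : ℝ) ≤
      (⌈(S.card : ℝ) / c⌉₊ / ((S.card : ℝ) / c)) *
        ((2 * α + 1) * (1 + 1 / (c : ℝ)) * mOpt G S c) := by
  obtain ⟨hmb, hle⟩ := messageEfficient_spec (S := S) (by omega) hcds hc
  obtain ⟨τ, hτ, hτlen⟩ := hmb.exists_length_eq_mOpt
  have hm1 : (S.card : ℝ) ≤ mOpt G S c := by
    exact_mod_cast hτlen ▸ hτ.card_le_length hn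
  have hm2 : (S.card : ℝ) * minCDS G ≤ c * mOpt G S c := by
    exact_mod_cast hτlen ▸ hτ.card_mul_minCDS_le hn
  have hk : (0 : ℝ) < S.card := by exact_mod_cast (show 0 < S.card by omega)
  have hc0 : (0 : ℝ) < c := by exact_mod_cast hc
  refine le_trans ?_ (message_bound hk hc0 hα hm1 hm2)
  have hq : (((S.card + c - 1) / c : ℕ) : ℝ) ≤ ⌈(S.card : ℝ) / c⌉₊ := by
    exact_mod_cast add_sub_one_div_le_ceil hc
  have hle' : ((messageEfficient G cds (S.sort (· ≤ ·)) c).val.length : ℝ) ≤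
      S.card + (2 * cds.val.length + 1) * (((S.card + c - 1) / c : ℕ) : ℝ) := by
    exact_mod_cast hle
  refine hle'.trans (add_le_add_right (mul_le_mul (by linarith) hq (Nat.cast_nonneg _) ?_) _)
  positivity

/-- A subroutine that finds a connected dominating set of at most `α` times the minimum size makes the
whole algorithm a `(2 α + 1) (1 + 1 / c)`-approximation. -/
theorem approximates_of_length_le {G : SimpleGraph (Fin n)} [DecidableRel G.Adj]
    {cds : Timed (List (Fin n))} {S : Finset (Fin n)} {c : ℕ} {α α' : ℝ} (hn : 2 ≤ n)
    (hc : 1 ≤ c) (hcS : c ≤ S.card) (hcost : cds.cost ≤ (n + 2) ^ 20) (hnodup : cds.val.Nodup)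
    (hcds : IsCDS G cds.val.toFinset) (hα : 0 ≤ α) (hlen : (cds.val.length : ℝ) ≤ α * minCDS G)
    (hα' : α ≤ α') :
    Approximates G cds S c α' ((2 * α + 1) * (1 + 1 / (c : ℝ))) ((n + 2) ^ 26) := by
  have hgen := length_messageEfficient_le hn hc hcS hcds hα hlen
  refine ⟨messageEfficient_cost_le hcost hnodup S hc, ⟨hcds, hlen.trans ?_⟩,
    (messageEfficient_spec (by omega) hcds hc).1, fun hdvd => ?_, hgen⟩
  · exact mul_le_mul_of_nonneg_right hα' (Nat.cast_nonneg _)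
  · rwa [rounding_factor_eq_one (by omega) hdvd, one_mul] at hgen

end MultiBroadcast

theorem mainTheorem1 :
    ∃ P : Polynomial ℕ, ∀ (n : ℕ) (G : SimpleGraph (Fin n)) [DecidableRel G.Adj]
      (S : Finset (Fin n)) (c : ℕ), 2 ≤ n → G.Connected → 1 ≤ c → c ≤ S.card →
      MultiBroadcast.Approximates G (MultiBroadcast.greedyCDS G) S c
        (2 + (harmonic G.maxDegree : ℝ))
        ((2 * (harmonic G.maxDegree : ℝ) + 5) * (1 + 1 / (c : ℝ))) (P.eval n) ∧
      (MultiBroadcast.IsUnitDiskGraph G →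
        MultiBroadcast.Approximates G (MultiBroadcast.misCDS G) S c
          7.8 (15.6 * (1 + 1 / (c : ℝ))) (P.eval n)) := by
  have heval : ∀ k : ℕ, ∃ P : Polynomial ℕ, ∀ n, P.eval n = (n + 2) ^ k :=
    fun k => ⟨(Polynomial.X + 2) ^ k, fun n => by simp⟩
  obtain ⟨P, hP⟩ := heval 26
  refine ⟨P, fun n G _ S c hn hG hc hcS => ?_⟩
  rw [hP]
  constructor
  · have h0 : (0 : ℝ) ≤ (harmonic G.maxDegree : ℝ) := by
      exact_mod_cast Finset.sum_nonneg fun i _ => by positivity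
    have h := MultiBroadcast.approximates_of_length_le hn hc hcS
      MultiBroadcast.greedyCDS_cost_le (MultiBroadcast.nodup_greedyCDS G)
      (MultiBroadcast.isCDS_greedyCDS hn hG) (by positivity)
      (MultiBroadcast.length_greedyCDS_le hG) le_rfl
    rwa [show 2 * (harmonic G.maxDegree : ℝ) + 5 = 2 * (2 + (harmonic G.maxDegree : ℝ)) + 1 by ring]
  · intro hudg
    -- The ratio `7.3` is what `15.6 = 2 * 7.3 + 1` leaves for the connected dominating set.
    have h := MultiBroadcast.approximates_of_length_le (α := 7.3) (α' := 7.8) hn hc hcS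
      MultiBroadcast.misCDS_cost_le (MultiBroadcast.nodup_misCDS (by omega))
      (MultiBroadcast.isCDS_misCDS hG (by omega)) (by norm_num)
      (MultiBroadcast.length_misCDS_le hudg hG (by omega)) (by norm_num)
    rwa [show (15.6 : ℝ) = 2 * 7.3 + 1 by norm_num]
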